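/- **Setting.** Let $p,q\in\mathbb N$. Let $(\mathbf X,\mathbf Y)$ and $(\mathbf X_n,\mathbf Y_n)$, $n\in\mathbb N$, be $(p+q)$-dimensional real random vectors, with $\mathbf Y=(Y_1,\dots,Y_q)$ and $\mathbf Y_n=(Y_{1,n},\dots,Y_{q,n})$; different vectors may live on different probability spaces. For a random vector $\mathbf Z$ and a non-degenerate (not almost surely constant) real random variable $Y$ on the same probability space, put $$\xi(Y,\mathbf Z)=\frac{\int_{\mathbb R}\operatorname{Var}\bigl(P(Y\ge y\mid \mathbf Z)\bigr)\,dP^Y(y)}{\int_{\mathbb R}\operatorname{Var}\bigl(\mathbf 1_{\{Y\ge y\}}\bigr)\,dP^Y(y)}.$$ If $\mathbf Y$ has non-degenerate components, put $$T(\mathbf Y,\mathbf X)=1-\frac{q-\sum_{i=1}^q\xi\bigl(Y_i,(\mathbf X,Y_1,\dots,Y_{i-1})\bigr)}{q-\sum_{i=1}^q\xi\bigl(Y_i,(Y_1,\dots,Y_{i-1})\bigr)},\qquad \xi(Y_1,\emptyset):=0.$$ The *Markov product* of $(\mathbf Z,Y)$ is the bivariate random vector $(Y,Y')$ (determined in law),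 where $Y'$ has the same conditional distribution given $\mathbf Z$ as $Y$, and $Y,Y'$ are conditionally independent given $\mathbf Z$. Let $\mathcal U$ be a class of bounded continuous functions $\mathbb R\to\mathbb C$ that is weak convergence-determining: if $\int u\,d\nu_n\to\int u\,d\nu$ for all $u\in\mathcal U$, where $\nu_n,\nu$ are probability measures on $\mathbb R$, then $\nu_n\to\nu$ weakly. A sequence of functions $f_n:\mathbb R^d\to\mathbb C$ is *asymptotically equicontinuous* on an open set $V\subset\mathbb R^d$ if for all $\varepsilon>0$ and $x\in V$ there are $\delta>0$ and $N\in\mathbb N$ such that $|f_n(x')-f_n(x)|<\varepsilon$ whenever $|x'-x|\le\delta$ and $n>N$. Write $F_Z$ for the distribution function of $Z$, and $F^{-1}(t)=\inf\{x: F(x)\ge t\}$. Let $V_1\subset\mathbb R^p$ be open with $P(\mathbf X\in V_1)=1$ and, for $i\in\{2,\dots,q\}$, let $U_i\subset\mathbb R^{i-1}$ and $V_i\subset\mathbb R^{p+i-1}$ be open with $P((Y_1,\dots,Y_{i-1})\in U_i)=1$ and $P((\mathbf X,Y_1,\dots,Y_{i-1})\in V_i)=1$. Consider the following conditions. 1.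 $(\mathbf X_n,\mathbf Y_n)\to(\mathbf X,\mathbf Y)$ in distribution. 2. For all $u\in\mathcal U$, the sequence $\bigl(\mathbb E[u(Y_{1,n})\mid\mathbf X_n=\mathbf x]\bigr)_n$ is asymptotically equicontinuous on $V_1$ and, for all $i\in\{2,\dots,q\}$, $\bigl(\mathbb E[u(Y_{i,n})\mid(\mathbf X_n,Y_{1,n},\dots,Y_{i-1,n})=\mathbf z]\bigr)_n$ is asymptotically equicontinuous on $V_i$, and $\bigl(\mathbb E[u(Y_{i,n})\mid(Y_{1,n},\dots,Y_{i-1,n})=\mathbf y]\bigr)_n$ is asymptotically equicontinuous on $U_i$, each for suitable versions of the conditional expectations (which may depend on $u$). 3. The Markov product of $(\mathbf X_n,Y_{1,n})$ converges weakly to that of $(\mathbf X,Y_1)$; and for all $i\in\{2,\dots,q\}$, the Markov product of $((\mathbf X_n,Y_{1,n},\dots,Y_{i-1,n}),Y_{i,n})$ converges weakly to that of $((\mathbf X,Y_1,\dots,Y_{i-1}),Y_i)$, and the Markov product of $((Y_{1,n},\dots,Y_{i-1,n}),Y_{i,n})$ converges weakly to that of $((Y_1,\dots,Y_{i-1}),Y_i)$.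 4. For all $i\in\{1,\dots,q\}$, $F_{Y_{i,n}}(F_{Y_{i,n}}^{-1}(t))\to F_{Y_i}(F_{Y_i}^{-1}(t))$ as $n\to\infty$ for Lebesgue-almost all $t\in(0,1)$. **Claim.** (a) Conditions 1 and 2 together imply condition 3. (b) If $Y_1,\dots,Y_q$ are non-degenerate, then conditions 3 and 4 together imply $\lim_{n\to\infty}T(\mathbf Y_n,\mathbf X_n)=T(\mathbf Y,\mathbf X)$. (Under condition 4 the components of $\mathbf Y_n$ are then non-degenerate for all large $n$, so that $T(\mathbf Y_n,\mathbf X_n)$ is defined for those $n$.) -/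

import Mathlib

open MeasureTheory ProbabilityTheory Filter Topology Set
open scoped BoundedContinuousFunction

noncomputable section

namespace MultiOutput

/-- A class `U` of bounded continuous functions `E → ℂ` is weak convergence-determining: convergence
of the integrals of every `u ∈ U` implies weak convergence of the probability measures. -/
def IsConvergenceDetermining {E : Type*} [TopologicalSpace E] [MeasurableSpace E]
    [OpensMeasurableSpace E] (U : Set (E →ᵇ ℂ)) : Prop :=
  ∀ (ν : ℕ → ProbabilityMeasure E) (ν' : ProbabilityMeasure E),
    (∀ u ∈ U, Tendsto (fun n => ∫ x, u x ∂(ν n : Measure E)) atTop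
      (𝓝 (∫ x, u x ∂(ν' : Measure E)))) →
    Tendsto ν atTop (𝓝 ν')

/-- Asymptotic equicontinuity of `(f n)` on `V`. For `E = ℝᵈ` the notion is the same for all
(equivalent) norms. -/
def AsympEquicontinuousOn {E : Type*} [PseudoMetricSpace E] (f : ℕ → E → ℂ) (V : Set E) : Prop :=
  ∀ ε > (0 : ℝ), ∀ x ∈ V, ∃ δ > (0 : ℝ), ∃ N : ℕ, ∀ x', dist x' x ≤ δ → ∀ n > N, ‖f n x' - f n x‖ < ε

/-- `g` is a version of `z ↦ 𝔼[W | Z = z]`. -/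
def IsCondExpVersion {Ω E : Type*} [MeasurableSpace Ω] [mE : MeasurableSpace E] (P : Measure Ω)
    (Z : Ω → E) (W : Ω → ℂ) (g : E → ℂ) : Prop :=
  Measurable g ∧ P[W | mE.comap Z] =ᵐ[P] fun ω => g (Z ω)

/-- The Markov product of `(Z, Y)`, i.e. the law of `(Y, Y')` where, given `Z`, the variable `Y'` is
a conditionally independent copy of `Y`: given `Z = z`, the pair has the law
`P^{Y | Z = z} ⊗ P^{Y | Z = z}`. -/
def markovProduct {Ω E : Type*} [MeasurableSpace Ω] [MeasurableSpace E] (P : Measure Ω)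
    [IsProbabilityMeasure P] {Z : Ω → E} (hZ : Measurable Z) (Y : Ω → ℝ) :
    ProbabilityMeasure (ℝ × ℝ) :=
  ⟨(P.map Z).bind (fun z => (condDistrib Y Z P z).prod (condDistrib Y Z P z)), by
    have h1 : IsProbabilityMeasure (P.map Z) := Measure.isProbabilityMeasure_map hZ.aemeasurable
    have h2 : (fun z => (condDistrib Y Z P z).prod (condDistrib Y Z P z))
        = (condDistrib Y Z P ×ₖ condDistrib Y Z P) := by
      funext z
      rw [Kernel.prod_apply]
    rw [h2]
    infer_instance⟩

/-- `markovProduct` is the law of `(Y, Y')` whenever `Y'` has the same conditional distribution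
given `Z` as `Y`, and `Y`, `Y'` are conditionally independent given `Z`. -/
theorem map_eq_markovProduct {Ω E : Type*} [MeasurableSpace Ω] [StandardBorelSpace Ω]
    [MeasurableSpace E] (P : Measure Ω) [IsProbabilityMeasure P] {Z : Ω → E} (hZ : Measurable Z)
    {Y Y' : Ω → ℝ} (hY : Measurable Y) (hY' : Measurable Y')
    (hcopy : condDistrib Y' Z P =ᵐ[P.map Z] condDistrib Y Z P)
    (hind : CondIndepFun (MeasurableSpace.comap Z inferInstance) hZ.comap_le Y Y' P) :
    P.map (fun ω => (Y ω, Y' ω)) = (markovProduct P hZ Y : Measure (ℝ × ℝ)) := by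
  have h := (condIndepFun_iff_map_prod_eq_prod_condDistrib_prod_condDistrib hY hY' hZ).1 hind
  have h' := congrArg (fun m => m.map Prod.snd) h
  rw [Measure.map_map measurable_snd (by fun_prop), Measure.map_comp _ _ measurable_snd] at h'
  have hs : (Kernel.id ×ₖ (condDistrib Y Z P ×ₖ condDistrib Y' Z P)).map Prod.snd
      = condDistrib Y Z P ×ₖ condDistrib Y' Z P := by
    rw [← Kernel.snd_eq, Kernel.snd_prod]
  rw [hs] at h'
  refine h'.trans ?_
  refine Measure.bind_congr_right ?_
  filter_upwards [hcopy] with z hz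
  rw [Kernel.prod_apply, hz]

/-- Chatterjee's rank correlation `ξ(Y, Z)`. -/
def xi {Ω E : Type*} [MeasurableSpace Ω] [mE : MeasurableSpace E] (P : Measure Ω)
    (Y : Ω → ℝ) (Z : Ω → E) : ℝ :=
  (∫ y, Var[P⟦{ω | y ≤ Y ω} | mE.comap Z⟧; P] ∂(P.map Y)) /
    (∫ y, Var[{ω | y ≤ Y ω}.indicator (fun _ => (1 : ℝ)); P] ∂(P.map Y))

/-- The vector of the components of `Y` that precede the `i`-th one. -/
def prev {Ω : Type*} {q : ℕ} (Y : Ω → Fin q → ℝ) (i : Fin q) : Ω → Fin i.val → ℝ :=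
  fun ω j => Y ω (Fin.castLE i.isLt.le j)

/-- The vector `X` together with the components of `Y` that precede the `i`-th one; an element of
`ℝᵖ × ℝⁱ = ℝᵖ⁺ⁱ` (indices start at `0`, so that for `i = 0` this is just `X`). -/
def inputPrev {Ω : Type*} {p q : ℕ} (X : Ω → Fin p → ℝ) (Y : Ω → Fin q → ℝ) (i : Fin q) :
    Ω → (Fin p → ℝ) × (Fin i.val → ℝ) :=
  fun ω => (X ω, prev Y i ω)

theorem measurable_prev {Ω : Type*} [MeasurableSpace Ω] {q : ℕ} {Y : Ω → Fin q → ℝ}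
    (hY : Measurable Y) (i : Fin q) : Measurable (prev Y i) :=
  measurable_pi_lambda _ fun _ => (measurable_pi_apply _).comp hY

theorem measurable_inputPrev {Ω : Type*} [MeasurableSpace Ω] {p q : ℕ} {X : Ω → Fin p → ℝ}
    {Y : Ω → Fin q → ℝ} (hX : Measurable X) (hY : Measurable Y) (i : Fin q) :
    Measurable (inputPrev X Y i) :=
  hX.prodMk (measurable_prev hY i)

/-- The multi-output extension `T(Y, X)` of `ξ`, with the convention `ξ(Y₁, ∅) = 0`. -/
def T {Ω : Type*} [MeasurableSpace Ω] {p q : ℕ} (P : Measure Ω) (Y : Ω → Fin q → ℝ)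
    (X : Ω → Fin p → ℝ) : ℝ :=
  1 - (q - ∑ i : Fin q, xi P (fun ω => Y ω i) (inputPrev X Y i)) /
      (q - ∑ i : Fin q, if i.val = 0 then 0 else xi P (fun ω => Y ω i) (prev Y i))

/-- The quantile function `F⁻¹(t) = inf {x | t ≤ F x}`. -/
def quantile (F : ℝ → ℝ) (t : ℝ) : ℝ :=
  sInf {x | t ≤ F x}

end MultiOutput

end

/-! (a) Let `G = 𝔼[u(Y) | Z]`. Conditional independence gives `𝔼[w(Y) u(Y')] = 𝔼[w(Y) G(Z)]` for the
Markov product. Weak convergence does not apply directly, because neither `G` nor its analogues `G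
n` need be continuous. Replace `G` by a bounded continuous `φ` that is close in `L¹`; what has to be
shown is that `𝔼‖G n(Z n) - φ(Z n)‖` is asymptotically no larger than `𝔼‖G(Z) - φ(Z)‖`
(`eventually_integral_norm_sub_le`). A partition of unity `f i` localises to small balls on which `G
n - φ` is almost constant. There the `L¹` norm is nearly `‖𝔼[f i (G n - φ)]‖ = ‖𝔼[f i(Z n) (u(Y n) -
φ(Z n))]‖`, whose integrand is continuous and free of `G n`, so it converges. A reweighting argument
passes from `𝒰` to all bounded continuous functions (`tendsto_integral_mul`), and characteristic
functions give weak convergence.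

(b) Let `A` be independent of the Markov product `(Y, Y')` and let `A, B, B'` be i.i.d. with the law
of `Y`. Then `ξ` is the quotient of `P(A ≤ min Y Y') - P(A ≤ min B B')` by `P(A ≤ B) - P(A ≤ min B
B')` (`xi_eq`). The event `{a ≤ b}` is closed, so weak convergence only bounds such probabilities
from above in the limit. But the probabilities for `min` and `max` add up to `2 P(A ≤ B)`, and `P(A
≤ B) = ∫ F(F⁻¹(t)) dt` converges by condition 4; two upper bounds with a convergent sum force
convergence of both (`tendsto_probLe_minLaw`). -/

noncomputable section

namespace MultiOutput

/-! ### L¹ approximation under asymptotic equicontinuity -/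

section Approximation

variable {E F : Type*} [MetricSpace E] [ProperSpace E] [MeasurableSpace E] [BorelSpace E]
  [MetricSpace F] [SecondCountableTopology F] [MeasurableSpace F] [BorelSpace F]

theorem tendsto_integral_of_continuous {𝕜 : Type*} [RCLike 𝕜] {S : Type*} [TopologicalSpace S]
    [MeasurableSpace S] [OpensMeasurableSpace S]
    {μ : ℕ → ProbabilityMeasure S} {μ' : ProbabilityMeasure S} (h : Tendsto μ atTop (𝓝 μ'))
    {f : S → 𝕜} (hf : Continuous f) {C : ℝ} (hC : ∀ x, ‖f x‖ ≤ C) :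
    Tendsto (fun n => ∫ x, f x ∂(μ n : Measure S)) atTop (𝓝 (∫ x, f x ∂(μ' : Measure S))) :=
  (ProbabilityMeasure.tendsto_iff_forall_integral_rclike_tendsto 𝕜).1 h
    (BoundedContinuousFunction.ofNormedAddCommGroup f hf C hC)

/-- If `h` oscillates by at most `η` on the support of the bump function `f`, then the integral of
`f * ‖h‖` is comparable with the norm of the integral of `f * h`. -/
theorem integral_bump_mul_norm_le {S : Type*} [MeasurableSpace S] (μ : Measure S)
    {f : S → ℝ} (hf0 : ∀ x, 0 ≤ f x) (hf : Integrable f μ) {h : S → ℂ} {c : ℂ} {η : ℝ}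
    (hfh : Integrable (fun x => f x • h x) μ)
    (hosc : ∀ x, f x ≠ 0 → ‖h x - c‖ ≤ η) :
    ∫ x, f x * ‖h x‖ ∂μ ≤ ‖∫ x, f x • h x ∂μ‖ + 2 * η * ∫ x, f x ∂μ := by
  have hfh' : Integrable (fun x => f x * ‖h x‖) μ := by
    refine hfh.norm.congr (ae_of_all _ fun x => ?_)
    simp [abs_of_nonneg (hf0 x)]
  -- Both integrals are compared with `‖c‖ * ∫ f`, at a cost of `η * ∫ f` each.
  have h1 : ∫ x, f x * ‖h x‖ ∂μ ≤ ∫ x, f x * (‖c‖ + η) ∂μ := by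
    refine integral_mono hfh' (hf.mul_const _) fun x => ?_
    by_cases hx : f x = 0
    · simp [hx]
    · refine mul_le_mul_of_nonneg_left ?_ (hf0 x)
      have := norm_le_norm_add_norm_sub' (h x) c
      linarith [hosc x hx]
  have h2 : ‖(∫ x, f x • h x ∂μ) - ∫ x, f x • c ∂μ‖ ≤ ∫ x, f x * η ∂μ := by
    rw [← integral_sub hfh (hf.smul_const c)]
    refine norm_integral_le_of_norm_le (hf.mul_const _) (ae_of_all _ fun x => ?_)
    by_cases hx : f x = 0
    · simp [hx]
    · rw [← smul_sub, norm_smul, Real.norm_of_nonneg (hf0 x)]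
      exact mul_le_mul_of_nonneg_left (hosc x hx) (hf0 x)
  have h3 : ‖∫ x, f x • c ∂μ‖ = (∫ x, f x ∂μ) * ‖c‖ := by
    rw [integral_smul_const, norm_smul, Real.norm_of_nonneg (integral_nonneg hf0)]
  rw [integral_mul_const] at h1 h2
  have h4 := norm_le_norm_add_norm_sub' (∫ x, f x • c ∂μ) (∫ x, f x • h x ∂μ)
  rw [norm_sub_rev] at h2
  linarith

/-- Compact subsets of an open set of full measure carry almost all of the mass. -/
theorem exists_isCompact_measureReal_compl_lt (m : Measure E) [IsProbabilityMeasure m]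
    {V : Set E} (hV : IsOpen V) (hm : m V = 1) {ε : ℝ} (hε : 0 < ε) :
    ∃ K ⊆ V, IsCompact K ∧ m.real Kᶜ < ε := by
  obtain ⟨K, hKV, hK, hlt⟩ := hV.measurableSet.exists_isCompact_lt_add (μ := m)
    (measure_ne_top _ _) (ε := ENNReal.ofReal ε) (by simpa using hε)
  refine ⟨K, hKV, hK, ?_⟩
  rw [hm] at hlt
  have h1 : (1 : ℝ) < m.real K + ε := by
    have := (ENNReal.toReal_lt_toReal (by simp) (by simp)).2 hlt
    rwa [ENNReal.toReal_add (by simp) (by simp), ENNReal.toReal_ofReal hε.le] at this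
  rw [probReal_compl_eq_one_sub hK.measurableSet]
  linarith

/-- Asymptotically equicontinuous versions `G n` of conditional expectations of `u` given the
first coordinate are asymptotically as close to a continuous function `φ` as the limiting
conditional expectation is. -/
theorem eventually_integral_norm_sub_le
    {lam : ℕ → ProbabilityMeasure (E × F)} {lam' : ProbabilityMeasure (E × F)}
    (hlam : Tendsto lam atTop (𝓝 lam')) (u : F →ᵇ ℂ) {G : ℕ → E → ℂ} {G' : E → ℂ}
    (hG : ∀ n, Measurable (G n)) (hG' : Measurable G')
    (hGb : ∀ n, ∀ᵐ z ∂(lam n : Measure (E × F)), ‖G n z.1‖ ≤ ‖u‖)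
    (hGb' : ∀ᵐ z ∂(lam' : Measure (E × F)), ‖G' z.1‖ ≤ ‖u‖)
    (hGc : ∀ n, ∀ f : E →ᵇ ℝ, ∫ z, f z.1 • G n z.1 ∂(lam n : Measure (E × F))
      = ∫ z, f z.1 • u z.2 ∂(lam n : Measure (E × F)))
    (hGc' : ∀ f : E →ᵇ ℝ, ∫ z, f z.1 • G' z.1 ∂(lam' : Measure (E × F))
      = ∫ z, f z.1 • u z.2 ∂(lam' : Measure (E × F)))
    {V : Set E} (hV : IsOpen V) (hVm : (lam' : Measure (E × F)) (Prod.fst ⁻¹' V) = 1)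
    (heq : AsympEquicontinuousOn G V) (φ : E →ᵇ ℂ) {ε : ℝ} (hε : 0 < ε) :
    ∀ᶠ n in atTop, ∫ z, ‖G n z.1 - φ z.1‖ ∂(lam n : Measure (E × F))
      ≤ ∫ z, ‖G' z.1 - φ z.1‖ ∂(lam' : Measure (E × F)) + ε := by
  -- `M` bounds `G n - φ` and `G' - φ` almost everywhere; the summand `1` keeps it positive, so that
  -- the mass off `K` can be made less than `ε / (4 * M)`.
  set M : ℝ := ‖u‖ + ‖φ‖ + 1 with hM
  have hM0 : 0 < M := by positivity
  have : IsProbabilityMeasure ((lam' : Measure (E × F)).map Prod.fst) :=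
    Measure.isProbabilityMeasure_map measurable_fst.aemeasurable
  obtain ⟨K, hKV, hK, hKm⟩ := exists_isCompact_measureReal_compl_lt
    ((lam' : Measure (E × F)).map Prod.fst) hV
    (by rw [Measure.map_apply measurable_fst hV.measurableSet, hVm])
    (ε := ε / (4 * M)) (by positivity)
  rw [measureReal_def, Measure.map_apply measurable_fst hK.measurableSet.compl] at hKm
  -- radii on which `G n - φ` oscillates by less than `ε / 4`
  have hrad : ∀ x ∈ K, ∃ δ > (0 : ℝ), ∃ N : ℕ, ∀ y, dist y x < δ → ∀ n > N,
      ‖(G n y - φ y) - (G n x - φ x)‖ ≤ ε / 4 := by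
    intro x hx
    obtain ⟨δ, hδ, N, h⟩ := heq (ε / 8) (by positivity) x (hKV hx)
    obtain ⟨δ', hδ', h'⟩ := Metric.continuous_iff.1 φ.continuous x (ε / 8) (by positivity)
    refine ⟨min δ δ', lt_min hδ hδ', N, fun y hy n hn => ?_⟩
    have h1 := h y (hy.le.trans (min_le_left _ _)) n hn
    have h2 := h' y (hy.trans_le (min_le_right _ _))
    rw [dist_eq_norm] at h2
    calc ‖(G n y - φ y) - (G n x - φ x)‖ = ‖(G n y - G n x) - (φ y - φ x)‖ := by ring_nf
      _ ≤ ‖G n y - G n x‖ + ‖φ y - φ x‖ := norm_sub_le _ _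
      _ ≤ ε / 4 := by linarith
  choose! δ hδ N hN using hrad
  obtain ⟨t, htK, htc⟩ := hK.elim_nhds_subcover (fun x => Metric.ball x (δ x))
    fun x hx => Metric.ball_mem_nhds x (hδ x hx)
  obtain ⟨f, hf⟩ := PartitionOfUnity.exists_isSubordinate (ι := t) hK.isClosed
    (fun x => Metric.ball x.1 (δ x.1)) (fun _ => Metric.isOpen_ball)
    (by intro x hx; simpa using htc hx)
  have hf0 : ∀ i x, 0 ≤ f i x := fun i x => f.nonneg i x
  have hf1 : ∀ i x, f i x ≤ 1 := fun i x => f.le_one i x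
  have hfs : ∀ x, ∑ i, f i x ≤ 1 := fun x => by
    rw [← finsum_eq_sum_of_fintype]; exact f.sum_le_one x
  have hfK : ∀ x ∈ K, ∑ i, f i x = 1 := fun x hx => by
    rw [← finsum_eq_sum_of_fintype]; exact f.sum_eq_one hx
  have hfc : ∀ i, Continuous (f i) := fun i => (f i).continuous
  have hfn : ∀ i x, ‖f i x‖ ≤ 1 := fun i x => by
    rw [Real.norm_of_nonneg (hf0 i x)]; exact hf1 i x
  have hrc : Continuous fun x => 1 - ∑ i, f i x := by fun_prop
  have hr0 : ∀ x, 0 ≤ 1 - ∑ i, f i x := fun x => by linarith [hfs x]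
  have hrn : ∀ x, ‖1 - ∑ i, f i x‖ ≤ 1 := fun x => by
    rw [Real.norm_of_nonneg (hr0 x)]
    linarith [Finset.sum_nonneg fun i (_ : i ∈ Finset.univ) => hf0 i x]
  -- integrability of the functions that occur
  have hInt : ∀ (ρ : ProbabilityMeasure (E × F)) {f : E × F → ℝ}, Continuous f → (∀ x, ‖f x‖ ≤ 1) →
      Integrable f (ρ : Measure (E × F)) := fun ρ f hf hb =>
    Integrable.of_bound hf.aestronglyMeasurable 1 (ae_of_all _ hb)
  have hIntC : ∀ (ρ : ProbabilityMeasure (E × F)) {f : E × F → ℝ} {g : E × F → ℂ} {C : ℝ},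
      Continuous f → (∀ x, ‖f x‖ ≤ 1) → Measurable g →
      (∀ᵐ x ∂(ρ : Measure (E × F)), ‖g x‖ ≤ C) →
      Integrable (fun x => f x • g x) (ρ : Measure (E × F)) := by
    intro ρ f g C hf hb hg hgb
    refine Integrable.of_bound (hf.measurable.smul hg).aestronglyMeasurable C ?_
    filter_upwards [hgb] with x hx
    rw [norm_smul]
    exact (mul_le_of_le_one_left (norm_nonneg _) (hb x)).trans hx
  have hIntN : ∀ (ρ : ProbabilityMeasure (E × F)) {g : E × F → ℂ} {C : ℝ}, Measurable g →
      (∀ᵐ x ∂(ρ : Measure (E × F)), ‖g x‖ ≤ C) →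
      Integrable g (ρ : Measure (E × F)) := fun ρ g C hg hgb =>
    Integrable.of_bound hg.aestronglyMeasurable C hgb
  have hbd : ∀ (ρ : ProbabilityMeasure (E × F)) {g : E → ℂ},
      (∀ᵐ z ∂(ρ : Measure (E × F)), ‖g z.1‖ ≤ ‖u‖) →
      ∀ᵐ z ∂(ρ : Measure (E × F)), ‖g z.1 - φ z.1‖ ≤ M := by
    intro ρ g hg
    filter_upwards [hg] with z hz
    have := norm_sub_le (g z.1) (φ z.1)
    linarith [φ.norm_coe_le_norm z.1]
  have hmG : ∀ {g : E → ℂ}, Measurable g → Measurable fun z : E × F => g z.1 - φ z.1 :=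
    fun hg => (hg.comp measurable_fst).sub (φ.continuous.measurable.comp measurable_fst)
  -- Against a continuous function of the first coordinate, the conditional expectation may be
  -- traded for `u` itself; the integrand becomes continuous.
  have hid : ∀ (ρ : ProbabilityMeasure (E × F)) {g : E → ℂ}, Measurable g →
      (∀ᵐ z ∂(ρ : Measure (E × F)), ‖g z.1‖ ≤ ‖u‖) →
      (∀ f : E →ᵇ ℝ, ∫ z, f z.1 • g z.1 ∂(ρ : Measure (E × F))
        = ∫ z, f z.1 • u z.2 ∂(ρ : Measure (E × F))) → ∀ i,
      ∫ z, f i z.1 • (g z.1 - φ z.1) ∂(ρ : Measure (E × F))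
        = ∫ z, f i z.1 • (u z.2 - φ z.1) ∂(ρ : Measure (E × F)) := by
    intro ρ g hg hgb hgc i
    have e := hgc (BoundedContinuousFunction.ofNormedAddCommGroup (f i) (hfc i) 1 (hfn i))
    simp only [BoundedContinuousFunction.coe_ofNormedAddCommGroup] at e
    have hφi := hIntC ρ (f := fun z => f i z.1) (g := fun z => φ z.1) (C := ‖φ‖)
      ((hfc i).comp continuous_fst) (fun z => hfn i z.1)
      (φ.continuous.measurable.comp measurable_fst) (ae_of_all _ fun z => φ.norm_coe_le_norm z.1)
    have hgi := hIntC ρ (f := fun z => f i z.1) (g := fun z => g z.1) (C := ‖u‖)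
      ((hfc i).comp continuous_fst) (fun z => hfn i z.1)
      (hg.comp measurable_fst) hgb
    have hui := hIntC ρ (f := fun z => f i z.1) (g := fun z => u z.2) (C := ‖u‖)
      ((hfc i).comp continuous_fst) (fun z => hfn i z.1)
      (u.continuous.measurable.comp measurable_snd) (ae_of_all _ fun z => u.norm_coe_le_norm z.2)
    simp only [smul_sub]
    rw [integral_sub hgi hφi, integral_sub hui hφi, e]
  have hfI : ∀ (ρ : ProbabilityMeasure (E × F)) i,
      Integrable (fun z : E × F => f i z.1) (ρ : Measure (E × F)) := fun ρ i =>
    hInt ρ ((hfc i).comp continuous_fst) fun z => hfn i z.1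
  have hrI : ∀ (ρ : ProbabilityMeasure (E × F)),
      Integrable (fun z : E × F => 1 - ∑ i, f i z.1) (ρ : Measure (E × F)) := fun ρ =>
    hInt ρ (hrc.comp continuous_fst) fun z => hrn z.1
  -- the upper bound, and its limit
  set B : ProbabilityMeasure (E × F) → ℝ := fun ρ =>
    ∑ i, (‖∫ z, f i z.1 • (u z.2 - φ z.1) ∂(ρ : Measure (E × F))‖
      + 2 * (ε / 4) * ∫ z, f i z.1 ∂(ρ : Measure (E × F)))
      + M * ∫ z, (1 - ∑ i, f i z.1) ∂(ρ : Measure (E × F)) with hB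
  have hBlim : Tendsto (fun n => B (lam n)) atTop (𝓝 (B lam')) := by
    refine Tendsto.add (tendsto_finsetSum _ fun i _ => Tendsto.add (Tendsto.norm ?_)
      (Tendsto.const_mul _ ?_)) (Tendsto.const_mul _ ?_)
    · refine tendsto_integral_of_continuous hlam (C := ‖u‖ + ‖φ‖)
        (((hfc i).comp continuous_fst).smul ((u.continuous.comp continuous_snd).sub
          (φ.continuous.comp continuous_fst))) fun z => ?_
      rw [norm_smul]
      refine (mul_le_of_le_one_left (norm_nonneg _) (hfn i z.1)).trans ((norm_sub_le _ _).trans ?_)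
      gcongr
      exacts [u.norm_coe_le_norm _, φ.norm_coe_le_norm _]
    · exact tendsto_integral_of_continuous hlam ((hfc i).comp continuous_fst) fun z => hfn i z.1
    · exact tendsto_integral_of_continuous hlam (hrc.comp continuous_fst) fun z => hrn z.1
  -- The oscillation terms cost at most `ε / 2` and the mass off `K` at most `ε / 4`, which leaves
  -- room for a strict inequality.
  have hBlt : B lam' < ∫ z, ‖G' z.1 - φ z.1‖ ∂(lam' : Measure (E × F)) + ε := by
    have hn : Integrable (fun z => ‖G' z.1 - φ z.1‖) (lam' : Measure (E × F)) :=
      (hIntN lam' (hmG hG') (hbd lam' hGb')).norm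
    have hni : ∀ i, Integrable (fun z => f i z.1 * ‖G' z.1 - φ z.1‖) (lam' : Measure (E × F)) :=
      fun i => hn.bdd_mul ((hfc i).comp continuous_fst).aestronglyMeasurable
        (ae_of_all _ fun z => hfn i z.1)
    have h1 : ∑ i, ‖∫ z, f i z.1 • (u z.2 - φ z.1) ∂(lam' : Measure (E × F))‖
        ≤ ∫ z, ‖G' z.1 - φ z.1‖ ∂(lam' : Measure (E × F)) := by
      calc _ ≤ ∑ i, ∫ z, f i z.1 * ‖G' z.1 - φ z.1‖ ∂(lam' : Measure (E × F)) := by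
            refine Finset.sum_le_sum fun i _ => ?_
            rw [← hid lam' hG' hGb' hGc' i]
            refine norm_integral_le_of_norm_le (hni i) (ae_of_all _ fun z => ?_)
            rw [norm_smul, Real.norm_of_nonneg (hf0 _ _)]
        _ = ∫ z, ∑ i, f i z.1 * ‖G' z.1 - φ z.1‖ ∂(lam' : Measure (E × F)) :=
            (integral_finsetSum _ fun i _ => hni i).symm
        _ ≤ _ := by
            refine integral_mono (integrable_finsetSum _ fun i _ => hni i) hn fun z => ?_
            simp only
            rw [← Finset.sum_mul]
            exact mul_le_of_le_one_left (norm_nonneg _) (hfs z.1)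
    have h2 : ∑ i, ∫ z, f i z.1 ∂(lam' : Measure (E × F)) ≤ 1 := by
      rw [← integral_finsetSum _ fun i _ => hfI lam' i]
      calc _ ≤ ∫ z, (1 : ℝ) ∂(lam' : Measure (E × F)) :=
            integral_mono (integrable_finsetSum _ fun i _ => hfI lam' i) (integrable_const _) fun z => hfs z.1
        _ = 1 := by simp
    have h3 : ∫ z, (1 - ∑ i, f i z.1) ∂(lam' : Measure (E × F)) ≤ ε / (4 * M) := by
      have hms : MeasurableSet ((Prod.fst : E × F → E) ⁻¹' Kᶜ) :=
        measurable_fst hK.measurableSet.compl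
      calc _ ≤ ∫ z, ((Prod.fst : E × F → E) ⁻¹' Kᶜ).indicator 1 z ∂(lam' : Measure (E × F)) := by
            refine integral_mono (hrI lam')
              ((integrable_const (1 : ℝ)).indicator hms) fun z => ?_
            by_cases hz : z.1 ∈ K
            · simp only [hfK z.1 hz]; simp [hz]
            · simp only [indicator, mem_preimage, mem_compl_iff, hz, not_false_eq_true, if_true,
                Pi.one_apply]
              linarith [Finset.sum_nonneg fun i (_ : i ∈ Finset.univ) => hf0 i z.1]
        _ = (lam' : Measure (E × F)).real ((Prod.fst : E × F → E) ⁻¹' Kᶜ) := by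
            rw [integral_indicator_one hms]
        _ ≤ _ := hKm.le
    have h4 : M * ∫ z, (1 - ∑ i, f i z.1) ∂(lam' : Measure (E × F)) ≤ ε / 4 := by
      calc _ ≤ M * (ε / (4 * M)) := mul_le_mul_of_nonneg_left h3 hM0.le
        _ = ε / 4 := by field_simp
    simp only [hB]
    rw [Finset.sum_add_distrib, ← Finset.mul_sum]
    nlinarith
  have hNev : ∀ᶠ n in atTop, ∀ i : t, N i.1 < n :=
    eventually_all.2 fun i => eventually_gt_atTop _
  filter_upwards [hBlim.eventually_lt_const hBlt, hNev] with n hn hNn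
  refine le_trans ?_ hn.le
  have hb := hbd (lam n) (hGb n)
  have hi := hIntN (lam n) (hmG (hG n)) hb
  have hni : ∀ i, Integrable (fun z => f i z.1 * ‖G n z.1 - φ z.1‖) (lam n : Measure (E × F)) :=
    fun i => hi.norm.bdd_mul ((hfc i).comp continuous_fst).aestronglyMeasurable
      (ae_of_all _ fun z => hfn i z.1)
  have hri := hrI (lam n)
  calc ∫ z, ‖G n z.1 - φ z.1‖ ∂(lam n : Measure (E × F))
      ≤ ∫ z, (∑ i, f i z.1 * ‖G n z.1 - φ z.1‖ + M * (1 - ∑ i, f i z.1))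
          ∂(lam n : Measure (E × F)) := by
        refine integral_mono_ae hi.norm
          ((integrable_finsetSum _ fun i _ => hni i).add (hri.const_mul M)) ?_
        filter_upwards [hb] with z hz
        rw [← Finset.sum_mul]
        nlinarith [hr0 z.1]
    _ = ∑ i, ∫ z, f i z.1 * ‖G n z.1 - φ z.1‖ ∂(lam n : Measure (E × F))
          + M * ∫ z, (1 - ∑ i, f i z.1) ∂(lam n : Measure (E × F)) := by
        rw [integral_add (integrable_finsetSum _ fun i _ => hni i) (hri.const_mul M),
          integral_finsetSum _ fun i _ => hni i, integral_const_mul]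
    _ ≤ B (lam n) := by
        simp only [hB]
        gcongr with i
        rw [← hid (lam n) (hG n) (hGb n) (hGc n) i]
        refine integral_bump_mul_norm_le _ (fun z : E × F => hf0 i z.1) (c := G n i.1 - φ i.1)
          (hfI (lam n) i)
          (hIntC (lam n) (f := fun z : E × F => f i z.1) ((hfc i).comp continuous_fst) (fun z => hfn i z.1) (hmG (hG n)) hb)
          fun z hz => ?_
        have hz' : z.1 ∈ Metric.ball i.1 (δ i.1) := hf i (subset_tsupport _ hz)
        exact hN i.1 (htK i.1 i.2) z.1 hz' n (hNn i)

end Approximation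

/-! ### Integrals against the Markov product and the joint law -/

section MarkovIntegrals

variable {Ω E : Type*} [MeasurableSpace Ω] [mE : MeasurableSpace E] (P : Measure Ω)
  [IsProbabilityMeasure P] {Z : Ω → E} (hZ : Measurable Z) {Y : Ω → ℝ} (hY : Measurable Y)

theorem coe_markovProduct (Y : Ω → ℝ) : (markovProduct P hZ Y : Measure (ℝ × ℝ))
    = (condDistrib Y Z P ×ₖ condDistrib Y Z P) ∘ₘ P.map Z := by
  have h2 : (fun z => (condDistrib Y Z P z).prod (condDistrib Y Z P z))
      = (condDistrib Y Z P ×ₖ condDistrib Y Z P) := by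
    funext z
    rw [Kernel.prod_apply]
  simp only [markovProduct, ProbabilityMeasure.coe_mk]
  rw [h2]

theorem integral_markovProduct_mul (w f : ℝ →ᵇ ℂ) :
    ∫ p, w p.1 * f p.2 ∂(markovProduct P hZ Y : Measure (ℝ × ℝ))
      = ∫ z, (∫ y, w y ∂condDistrib Y Z P z) * (∫ y, f y ∂condDistrib Y Z P z) ∂(P.map Z) := by
  have hI : Integrable (fun p : ℝ × ℝ => w p.1 * f p.2)
      (markovProduct P hZ Y : Measure (ℝ × ℝ)) := by
    refine Integrable.of_bound (Continuous.aestronglyMeasurable (by fun_prop)) (‖w‖ * ‖f‖)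
      (ae_of_all _ fun p => ?_)
    rw [norm_mul]
    gcongr
    exacts [w.norm_coe_le_norm _, f.norm_coe_le_norm _]
  rw [coe_markovProduct, Measure.comp_eq_comp_const_apply] at hI ⊢
  rw [Kernel.integral_comp hI, Kernel.const_apply]
  refine integral_congr_ae (ae_of_all _ fun z => ?_)
  simp only [Kernel.prod_apply]
  exact integral_prod_mul (fun y => w y) (fun y => f y)

theorem norm_integral_condDistrib_le (u : ℝ →ᵇ ℂ) (z : E) :
    ‖∫ y, u y ∂condDistrib Y Z P z‖ ≤ ‖u‖ := u.norm_integral_le_norm _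

theorem measurable_integral_condDistrib (u : ℝ →ᵇ ℂ) :
    Measurable fun z => ∫ y, u y ∂condDistrib Y Z P z :=
  (StronglyMeasurable.integral_kernel (κ := condDistrib Y Z P)
    u.continuous.stronglyMeasurable).measurable

include hZ hY in
-- The tower property. The bound on `h` is only almost sure, since versions of conditional
-- expectations are controlled only up to null sets.
theorem integral_map_prodMk_mul (u : ℝ →ᵇ ℂ) {h : E → ℂ} (hh : Measurable h) {C : ℝ}
    (hC : ∀ᵐ z ∂(P.map Z), ‖h z‖ ≤ C) :
    ∫ p, h p.1 * u p.2 ∂(P.map fun ω => (Z ω, Y ω))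
      = ∫ z, h z * ∫ y, u y ∂condDistrib Y Z P z ∂(P.map Z) := by
  have hI : Integrable (fun p : E × ℝ => h p.1 * u p.2) (P.map fun ω => (Z ω, Y ω)) := by
    refine Integrable.of_bound ((hh.comp measurable_fst).mul
      (u.continuous.measurable.comp measurable_snd)).aestronglyMeasurable (C * ‖u‖) ?_
    have h1 := ae_of_ae_map hZ.aemeasurable hC
    have hm : Measurable fun p : E × ℝ => ‖h p.1 * u p.2‖ :=
      ((hh.comp measurable_fst).mul (u.continuous.measurable.comp measurable_snd)).norm
    rw [ae_map_iff (hZ.prodMk hY).aemeasurable (measurableSet_le hm measurable_const)]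
    filter_upwards [h1] with ω hω
    rw [norm_mul]
    exact mul_le_mul hω (u.norm_coe_le_norm _) (norm_nonneg _) ((norm_nonneg _).trans hω)
  rw [← compProd_map_condDistrib hY.aemeasurable] at hI ⊢
  rw [Measure.integral_compProd hI]
  simp only [integral_const_mul]

include hZ hY in
theorem IsCondExpVersion.ae_eq {u : ℝ →ᵇ ℂ} {g : E → ℂ}
    (hg : IsCondExpVersion P Z (fun ω => u (Y ω)) g) :
    g =ᵐ[P.map Z] fun z => ∫ y, u y ∂condDistrib Y Z P z := by
  have h1 := condExp_ae_eq_integral_condDistrib (μ := P) hZ hY.aemeasurable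
    (f := fun y => u y) u.continuous.stronglyMeasurable
    (Integrable.of_bound (u.continuous.measurable.comp hY).aestronglyMeasurable ‖u‖
      (ae_of_all _ fun ω => u.norm_coe_le_norm _))
  rw [Filter.EventuallyEq, ae_map_iff hZ.aemeasurable
    (measurableSet_eq_fun hg.1 (measurable_integral_condDistrib P u))]
  filter_upwards [hg.2, h1] with ω h2 h3
  rw [← h2, h3]

end MarkovIntegrals

/-! ### From a convergence-determining class to weak convergence on the plane -/

section Determining

/-- The law on the second coordinate, after weighting the first coordinate with `w`. -/
def weightedSnd (Q : ProbabilityMeasure (ℝ × ℝ)) (w : ℝ →ᵇ ℝ) : Measure ℝ :=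
  (ENNReal.ofReal (∫ p, w p.1 ∂(Q : Measure (ℝ × ℝ))))⁻¹ •
    ((Q : Measure (ℝ × ℝ)).withDensity fun p => ENNReal.ofReal (w p.1)).map Prod.snd

theorem integrable_comp_fst (Q : ProbabilityMeasure (ℝ × ℝ)) (w : ℝ →ᵇ ℝ) :
    Integrable (fun p : ℝ × ℝ => w p.1) (Q : Measure (ℝ × ℝ)) :=
  Integrable.of_bound (Continuous.aestronglyMeasurable (by fun_prop)) ‖w‖
    (ae_of_all _ fun p => w.norm_coe_le_norm _)

theorem one_le_integral_fst (Q : ProbabilityMeasure (ℝ × ℝ)) {w : ℝ →ᵇ ℝ} (hw : ∀ y, 1 ≤ w y) :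
    1 ≤ ∫ p, w p.1 ∂(Q : Measure (ℝ × ℝ)) := by
  calc (1 : ℝ) = ∫ p, (1 : ℝ) ∂(Q : Measure (ℝ × ℝ)) := by simp
    _ ≤ _ := integral_mono (integrable_const _) (integrable_comp_fst Q w) fun p => hw p.1

theorem isProbabilityMeasure_weightedSnd (Q : ProbabilityMeasure (ℝ × ℝ)) {w : ℝ →ᵇ ℝ}
    (hw : ∀ y, 1 ≤ w y) : IsProbabilityMeasure (weightedSnd Q w) := by
  constructor
  have h1 := one_le_integral_fst Q hw
  rw [weightedSnd, Measure.smul_apply, Measure.map_apply measurable_snd MeasurableSet.univ,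
    preimage_univ, withDensity_apply _ MeasurableSet.univ, Measure.restrict_univ,
    ← ofReal_integral_eq_lintegral_ofReal (integrable_comp_fst Q w)
      (ae_of_all _ fun p => zero_le_one.trans (hw p.1)), smul_eq_mul]
  refine ENNReal.inv_mul_cancel ?_ ENNReal.ofReal_ne_top
  rw [Ne, ENNReal.ofReal_eq_zero, not_le]
  linarith

/-- `weightedSnd` as a probability measure. -/
def weightedLaw (Q : ProbabilityMeasure (ℝ × ℝ)) {w : ℝ →ᵇ ℝ} (hw : ∀ y, 1 ≤ w y) :
    ProbabilityMeasure ℝ :=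
  ⟨weightedSnd Q w, isProbabilityMeasure_weightedSnd Q hw⟩

theorem integral_weightedSnd (Q : ProbabilityMeasure (ℝ × ℝ)) {w : ℝ →ᵇ ℝ}
    (hw : ∀ y, 1 ≤ w y) (f : ℝ →ᵇ ℂ) :
    ∫ y, f y ∂(weightedSnd Q w) = (∫ p, w p.1 ∂(Q : Measure (ℝ × ℝ)))⁻¹ •
      ∫ p, (w p.1 : ℂ) * f p.2 ∂(Q : Measure (ℝ × ℝ)) := by
  have h1 := one_le_integral_fst Q hw
  rw [weightedSnd, integral_smul_measure, integral_map measurable_snd.aemeasurable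
      f.continuous.aestronglyMeasurable, integral_withDensity_eq_integral_toReal_smul
      (by fun_prop) (ae_of_all _ fun p => ENNReal.ofReal_lt_top), ENNReal.toReal_inv,
      ENNReal.toReal_ofReal (by linarith)]
  congr 1
  refine integral_congr_ae (ae_of_all _ fun p => ?_)
  simp only
  rw [ENNReal.toReal_ofReal (zero_le_one.trans (hw p.1)), Complex.real_smul]

variable {Q : ℕ → ProbabilityMeasure (ℝ × ℝ)} {Q' : ProbabilityMeasure (ℝ × ℝ)}

/-- Weighting by `w ≥ 1` and normalising yields probability measures on the line, to which the
determining property of `𝒰` applies. The normalising constants are at least `1` and converge, so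
they can be divided out and restored. -/
theorem tendsto_integral_mul_of_one_le {𝒰 : Set (ℝ →ᵇ ℂ)} (h𝒰 : IsConvergenceDetermining 𝒰)
    {w : ℝ →ᵇ ℝ} (hw : ∀ y, 1 ≤ w y)
    (hfst : Tendsto (fun n => ∫ p, w p.1 ∂(Q n : Measure (ℝ × ℝ))) atTop
      (𝓝 (∫ p, w p.1 ∂(Q' : Measure (ℝ × ℝ)))))
    (h : ∀ u ∈ 𝒰, Tendsto (fun n => ∫ p, (w p.1 : ℂ) * u p.2 ∂(Q n : Measure (ℝ × ℝ))) atTop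
      (𝓝 (∫ p, (w p.1 : ℂ) * u p.2 ∂(Q' : Measure (ℝ × ℝ))))) (f : ℝ →ᵇ ℂ) :
    Tendsto (fun n => ∫ p, (w p.1 : ℂ) * f p.2 ∂(Q n : Measure (ℝ × ℝ))) atTop
      (𝓝 (∫ p, (w p.1 : ℂ) * f p.2 ∂(Q' : Measure (ℝ × ℝ)))) := by
  have hne : ∀ R : ProbabilityMeasure (ℝ × ℝ), ∫ p, w p.1 ∂(R : Measure (ℝ × ℝ)) ≠ 0 := fun R => by
    linarith [one_le_integral_fst R hw]
  have hν : Tendsto (fun n => weightedLaw (Q n) hw) atTop (𝓝 (weightedLaw Q' hw)) := by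
    refine h𝒰 _ _ fun u hu => ?_
    simp only [weightedLaw, ProbabilityMeasure.coe_mk, integral_weightedSnd _ hw]
    exact (hfst.inv₀ (hne _)).smul (h u hu)
  have h2 := (ProbabilityMeasure.tendsto_iff_forall_integral_rclike_tendsto ℂ).1 hν f
  simp only [weightedLaw, ProbabilityMeasure.coe_mk, integral_weightedSnd _ hw] at h2
  simpa only [smul_inv_smul₀ (hne _)] using hfst.smul h2

/-- Convergence of the integrals of the tensor products of a convergence-determining class with
all bounded continuous functions extends to all tensor products. -/
theorem tendsto_integral_mul {𝒰 : Set (ℝ →ᵇ ℂ)} (h𝒰 : IsConvergenceDetermining 𝒰)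
    (hfst : ∀ w : ℝ →ᵇ ℝ, Tendsto (fun n => ∫ p, w p.1 ∂(Q n : Measure (ℝ × ℝ))) atTop
      (𝓝 (∫ p, w p.1 ∂(Q' : Measure (ℝ × ℝ)))))
    (h : ∀ w : ℝ →ᵇ ℂ, ∀ u ∈ 𝒰,
      Tendsto (fun n => ∫ p, w p.1 * u p.2 ∂(Q n : Measure (ℝ × ℝ))) atTop
        (𝓝 (∫ p, w p.1 * u p.2 ∂(Q' : Measure (ℝ × ℝ))))) (w f : ℝ →ᵇ ℂ) :
    Tendsto (fun n => ∫ p, w p.1 * f p.2 ∂(Q n : Measure (ℝ × ℝ))) atTop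
      (𝓝 (∫ p, w p.1 * f p.2 ∂(Q' : Measure (ℝ × ℝ)))) := by
  have key : ∀ v : ℝ →ᵇ ℝ, (∀ y, 1 ≤ v y) →
      Tendsto (fun n => ∫ p, (v p.1 : ℂ) * f p.2 ∂(Q n : Measure (ℝ × ℝ))) atTop
      (𝓝 (∫ p, (v p.1 : ℂ) * f p.2 ∂(Q' : Measure (ℝ × ℝ)))) := fun v hv =>
    tendsto_integral_mul_of_one_le h𝒰 hv (hfst v) (fun u hu => h
      (BoundedContinuousFunction.ofNormedAddCommGroup (fun y => (v y : ℂ)) (by fun_prop) ‖v‖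
        fun y => by rw [Complex.norm_real]; exact v.norm_coe_le_norm y) u hu) f
  -- The shift makes the real and imaginary parts at least `1`: `w = v1 + I * v2 - c * (1 + I)`.
  set c : ℝ := ‖w‖ + 1
  let v1 : ℝ →ᵇ ℝ := BoundedContinuousFunction.ofNormedAddCommGroup (fun y => (w y).re + c)
    (by fun_prop) (‖w‖ + ‖c‖) fun y => (norm_add_le _ _).trans
      (by gcongr; exact (Complex.abs_re_le_norm _).trans (w.norm_coe_le_norm y))
  let v2 : ℝ →ᵇ ℝ := BoundedContinuousFunction.ofNormedAddCommGroup (fun y => (w y).im + c)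
    (by fun_prop) (‖w‖ + ‖c‖) fun y => (norm_add_le _ _).trans
      (by gcongr; exact (Complex.abs_im_le_norm _).trans (w.norm_coe_le_norm y))
  have k1 := key v1 fun y => by
    have h1 := neg_le_of_abs_le (Complex.abs_re_le_norm (w y))
    have h2 := w.norm_coe_le_norm y
    simp only [v1, c, BoundedContinuousFunction.coe_ofNormedAddCommGroup]
    linarith
  have k2 := key v2 fun y => by
    have h1 := neg_le_of_abs_le (Complex.abs_im_le_norm (w y))
    have h2 := w.norm_coe_le_norm y
    simp only [v2, c, BoundedContinuousFunction.coe_ofNormedAddCommGroup]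
    linarith
  have k3 := key 1 fun y => le_rfl
  have hI : ∀ (v : ℝ →ᵇ ℝ) (R : ProbabilityMeasure (ℝ × ℝ)),
      Integrable (fun p : ℝ × ℝ => (v p.1 : ℂ) * f p.2) (R : Measure (ℝ × ℝ)) := fun v R => by
    refine Integrable.of_bound (Continuous.aestronglyMeasurable (by fun_prop)) (‖v‖ * ‖f‖)
      (ae_of_all _ fun p => ?_)
    rw [norm_mul, Complex.norm_real]
    gcongr
    exacts [v.norm_coe_le_norm _, f.norm_coe_le_norm _]
  have hdec : ∀ R : ProbabilityMeasure (ℝ × ℝ), ∫ p, w p.1 * f p.2 ∂(R : Measure (ℝ × ℝ))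
      = (∫ p, (v1 p.1 : ℂ) * f p.2 ∂(R : Measure (ℝ × ℝ)))
        + Complex.I * (∫ p, (v2 p.1 : ℂ) * f p.2 ∂(R : Measure (ℝ × ℝ)))
        - (c * (1 + Complex.I)) *
          ∫ p, ((1 : ℝ →ᵇ ℝ) p.1 : ℂ) * f p.2 ∂(R : Measure (ℝ × ℝ)) := by
    intro R
    rw [← integral_const_mul, ← integral_const_mul, ← integral_add (hI v1 R)
      ((hI v2 R).const_mul _), ← integral_sub _ ((hI 1 R).const_mul _)]
    swap
    · exact (hI v1 R).add ((hI v2 R).const_mul _)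
    refine integral_congr_ae (ae_of_all _ fun p => ?_)
    have hre := Complex.re_add_im (w p.1)
    simp only [v1, v2, BoundedContinuousFunction.coe_ofNormedAddCommGroup,
      BoundedContinuousFunction.coe_one, Pi.one_apply, Complex.ofReal_add, Complex.ofReal_one]
    linear_combination (-f p.2) * hre
  simp only [hdec]
  exact (k1.add (k2.const_mul _)).sub (k3.const_mul _)

/-- Convergence of the integrals of all tensor products implies weak convergence. -/
theorem tendsto_of_tendsto_integral_mul
    (h : ∀ w f : ℝ →ᵇ ℂ, Tendsto (fun n => ∫ p, w p.1 * f p.2 ∂(Q n : Measure (ℝ × ℝ))) atTop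
        (𝓝 (∫ p, w p.1 * f p.2 ∂(Q' : Measure (ℝ × ℝ))))) :
    Tendsto Q atTop (𝓝 Q') := by
  -- Characteristic functions need an inner product, so the laws are transported to the Euclidean
  -- plane; there characters are tensor products.
  have hm : Measurable (WithLp.toLp 2 : ℝ × ℝ → WithLp 2 (ℝ × ℝ)) := by fun_prop
  have hm' : Continuous (WithLp.ofLp : WithLp 2 (ℝ × ℝ) → ℝ × ℝ) := by fun_prop
  have key : Tendsto (fun n => (Q n).map hm.aemeasurable) atTop (𝓝 (Q'.map hm.aemeasurable)) := by
    refine ProbabilityMeasure.tendsto_of_tendsto_charFun fun t => ?_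
    have hc : ∀ R : ProbabilityMeasure (ℝ × ℝ),
        charFun (R.map hm.aemeasurable : Measure (WithLp 2 (ℝ × ℝ))) t
        = ∫ p, (BoundedContinuousFunction.innerProbChar t.fst p.1) *
          (BoundedContinuousFunction.innerProbChar t.snd p.2) ∂(R : Measure (ℝ × ℝ)) := by
      intro R
      rw [charFun_apply, ProbabilityMeasure.toMeasure_map, integral_map hm.aemeasurable
        (by fun_prop)]
      refine integral_congr_ae (ae_of_all _ fun p => ?_)
      simp only [BoundedContinuousFunction.innerProbChar_apply, WithLp.prod_inner_apply]
      rw [← Complex.exp_add]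
      congr 1
      push_cast
      simp only [WithLp.fst, WithLp.snd]
      ring
    simp only [hc]
    exact h _ _
  have h2 := ProbabilityMeasure.tendsto_map_of_tendsto_of_continuous _ _ key hm'
  have hid : ∀ R : ProbabilityMeasure (ℝ × ℝ),
      (R.map hm.aemeasurable).map hm'.measurable.aemeasurable = R := by
    intro R
    apply Subtype.ext
    simp only [ProbabilityMeasure.val_eq_to_measure, ProbabilityMeasure.toMeasure_map]
    rw [Measure.map_map hm'.measurable hm]
    exact Measure.map_id
  simpa only [hid] using h2

end Determining

/-! ### Weak convergence of Markov products -/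

section Convergence

variable {E : Type*} [MetricSpace E] [ProperSpace E] [MeasurableSpace E] [BorelSpace E]
  {Ω : Type*} [MeasurableSpace Ω] {P : Measure Ω} [IsProbabilityMeasure P]
  {Ω' : ℕ → Type*} [∀ n, MeasurableSpace (Ω' n)] {P' : ∀ n, Measure (Ω' n)}
  [∀ n, IsProbabilityMeasure (P' n)]
  {Z : Ω → E} {Y : Ω → ℝ} {Z' : ∀ n, Ω' n → E} {Y' : ∀ n, Ω' n → ℝ}

/-- The law of a pair as a probability measure. -/
def pairLaw {Ω : Type*} [MeasurableSpace Ω] (P : Measure Ω) [IsProbabilityMeasure P]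
    {Z : Ω → E} {Y : Ω → ℝ} (hZ : Measurable Z) (hY : Measurable Y) : ProbabilityMeasure (E × ℝ) :=
  ⟨P.map fun ω => (Z ω, Y ω), Measure.isProbabilityMeasure_map (hZ.prodMk hY).aemeasurable⟩

theorem norm_integral_mul_sub_le {S : Type*} [MeasurableSpace S] (μ : Measure S)
    {a b w : S → ℂ} {C : ℝ} (ha : Integrable a μ) (hb : Integrable b μ)
    (hwm : AEStronglyMeasurable w μ) (hw : ∀ x, ‖w x‖ ≤ C) :
    ‖(∫ x, a x * w x ∂μ) - ∫ x, b x * w x ∂μ‖ ≤ C * ∫ x, ‖a x - b x‖ ∂μ := by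
  rw [← integral_sub (ha.mul_bdd hwm (ae_of_all _ hw))
    (hb.mul_bdd hwm (ae_of_all _ hw)), ← integral_const_mul]
  refine norm_integral_le_of_norm_le ((ha.sub hb).norm.const_mul C) (ae_of_all _ fun x => ?_)
  rw [← sub_mul, norm_mul, mul_comm]
  exact mul_le_mul_of_nonneg_right (hw x) (norm_nonneg _)

/-- Both sides become integrals of a conditional expectation times `w` over the joint law; a common
continuous `φ` then replaces the conditional expectations, with small `L¹` error. -/
theorem tendsto_integral_markovProduct_mul (hZ : Measurable Z) (hY : Measurable Y)
    (hZ' : ∀ n, Measurable (Z' n)) (hY' : ∀ n, Measurable (Y' n))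
    (hlam : Tendsto (fun n => pairLaw (P' n) (hZ' n) (hY' n)) atTop (𝓝 (pairLaw P hZ hY)))
    {V : Set E} (hV : IsOpen V) (hPV : P {ω | Z ω ∈ V} = 1) (u : ℝ →ᵇ ℂ) {g : ℕ → E → ℂ}
    (hg : ∀ n, IsCondExpVersion (P' n) (Z' n) (fun ω => u (Y' n ω)) (g n))
    (heq : AsympEquicontinuousOn g V) (w : ℝ →ᵇ ℂ) :
    Tendsto (fun n => ∫ p, w p.1 * u p.2 ∂(markovProduct (P' n) (hZ' n) (Y' n) : Measure (ℝ × ℝ)))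
      atTop (𝓝 (∫ p, w p.1 * u p.2 ∂(markovProduct P hZ Y : Measure (ℝ × ℝ)))) := by
  set G' : E → ℂ := fun z => ∫ y, u y ∂condDistrib Y Z P z with hG'
  have hG'm : Measurable G' := measurable_integral_condDistrib P u
  have hG'b : ∀ z, ‖G' z‖ ≤ ‖u‖ := norm_integral_condDistrib_le P u
  have hge := fun n => (hg n).ae_eq (P' n) (hZ' n) (hY' n)
  have hgb : ∀ n, ∀ᵐ z ∂(P' n).map (Z' n), ‖g n z‖ ≤ ‖u‖ := fun n => by
    filter_upwards [hge n] with z hz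
    rw [hz]
    exact norm_integral_condDistrib_le (P' n) u z
  have hgb2 : ∀ n, ∀ᵐ z ∂(pairLaw (P' n) (hZ' n) (hY' n) : Measure (E × ℝ)),
      ‖g n z.1‖ ≤ ‖u‖ := fun n => by
    have h1 : ((pairLaw (P' n) (hZ' n) (hY' n) : Measure (E × ℝ))).map Prod.fst
        = (P' n).map (Z' n) := by
      simp only [pairLaw, ProbabilityMeasure.coe_mk]
      rw [Measure.map_map measurable_fst ((hZ' n).prodMk (hY' n))]
      rfl
    have h2 := hgb n
    rw [← h1] at h2
    exact ae_of_ae_map measurable_fst.aemeasurable h2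
  have e1 : ∀ n, ∫ p, w p.1 * u p.2 ∂(markovProduct (P' n) (hZ' n) (Y' n) : Measure (ℝ × ℝ))
      = ∫ z, g n z.1 * w z.2 ∂(pairLaw (P' n) (hZ' n) (hY' n) : Measure (E × ℝ)) := fun n => by
    simp only [pairLaw, ProbabilityMeasure.coe_mk]
    rw [integral_markovProduct_mul, integral_map_prodMk_mul (P' n) (hZ' n) (hY' n) w (hg n).1
      (hgb n)]
    refine integral_congr_ae ?_
    filter_upwards [hge n] with z hz
    rw [hz, mul_comm]
  have e2 : ∫ p, w p.1 * u p.2 ∂(markovProduct P hZ Y : Measure (ℝ × ℝ))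
      = ∫ z, G' z.1 * w z.2 ∂(pairLaw P hZ hY : Measure (E × ℝ)) := by
    simp only [pairLaw, ProbabilityMeasure.coe_mk]
    rw [integral_markovProduct_mul, integral_map_prodMk_mul P hZ hY w hG'm
      (ae_of_all _ hG'b)]
    simp only [mul_comm, hG']
  have hbcb : ∀ (f : E →ᵇ ℝ) (z : E), ‖(f z : ℂ)‖ ≤ ‖f‖ := fun f z => by
    rw [Complex.norm_real]; exact f.norm_coe_le_norm z
  have hcm : ∀ f : E →ᵇ ℝ, Measurable fun z => (f z : ℂ) := fun f =>
    Complex.measurable_ofReal.comp f.continuous.measurable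
  have one_mul_bcf : ∀ x : ℝ, (1 : ℝ →ᵇ ℂ) x = 1 := fun _ => rfl
  have ec : ∀ n, ∀ f : E →ᵇ ℝ,
      ∫ z, f z.1 • g n z.1 ∂(pairLaw (P' n) (hZ' n) (hY' n) : Measure (E × ℝ))
      = ∫ z, f z.1 • u z.2 ∂(pairLaw (P' n) (hZ' n) (hY' n) : Measure (E × ℝ)) := fun n f => by
    have h1 := integral_map_prodMk_mul (P' n) (hZ' n) (hY' n) u (hcm f)
      (ae_of_all _ (hbcb f))
    -- Taking the constant `1` as the function of `Y` reduces the integral to one over the law of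
    -- `Z' n`.
    have h2 := integral_map_prodMk_mul (P' n) (hZ' n) (hY' n) 1 (h := fun z => f z * g n z)
      ((hcm f).mul (hg n).1) (C := ‖f‖ * ‖u‖) (by
        filter_upwards [hgb n] with z hz
        rw [norm_mul]
        exact mul_le_mul (hbcb f z) hz (norm_nonneg _) (norm_nonneg _))
    simp only [one_mul_bcf, mul_one, integral_const, probReal_univ, one_smul] at h2
    simp only [pairLaw, ProbabilityMeasure.coe_mk, Complex.real_smul]
    rw [h1, h2]
    refine integral_congr_ae ?_
    filter_upwards [hge n] with z hz
    rw [hz]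
  have ec' : ∀ f : E →ᵇ ℝ, ∫ z, f z.1 • G' z.1 ∂(pairLaw P hZ hY : Measure (E × ℝ))
      = ∫ z, f z.1 • u z.2 ∂(pairLaw P hZ hY : Measure (E × ℝ)) := fun f => by
    have h1 := integral_map_prodMk_mul P hZ hY u (hcm f) (ae_of_all _ (hbcb f))
    have h2 := integral_map_prodMk_mul P hZ hY 1 (h := fun z => f z * G' z)
      ((hcm f).mul hG'm) (C := ‖f‖ * ‖u‖) (ae_of_all _ fun z => by
        rw [norm_mul]
        exact mul_le_mul (hbcb f z) (hG'b z) (norm_nonneg _) (norm_nonneg _))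
    simp only [one_mul_bcf, mul_one, integral_const, probReal_univ, one_smul] at h2
    simp only [pairLaw, ProbabilityMeasure.coe_mk, Complex.real_smul]
    rw [h1, h2]
  have hVm : (pairLaw P hZ hY : Measure (E × ℝ)) (Prod.fst ⁻¹' V) = 1 := by
    simp only [pairLaw, ProbabilityMeasure.coe_mk]
    rw [Measure.map_apply (hZ.prodMk hY) (measurable_fst hV.measurableSet)]
    exact hPV
  simp only [e1, e2]
  rw [Metric.tendsto_atTop']
  intro ε hε
  set W : ℝ := ‖w‖ + 1 with hW
  have hW0 : 0 < W := by positivity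
  have hwW : ∀ x, ‖w x‖ ≤ W := fun x => (w.norm_coe_le_norm x).trans (by linarith)
  have hG'i : Integrable (fun z => G' z.1) (pairLaw P hZ hY : Measure (E × ℝ)) :=
    Integrable.of_bound (hG'm.comp measurable_fst).aestronglyMeasurable ‖u‖
      (ae_of_all _ fun z => hG'b z.1)
  have : IsProbabilityMeasure (P.map Z) := Measure.isProbabilityMeasure_map hZ.aemeasurable
  -- Three errors of at most `ε / 4`: `g n` to `φ` (twice `ε / (8 * W)`, times `W`), weak
  -- convergence for `φ * w`, and `φ` to `G'`.
  obtain ⟨φ, hφ, -⟩ := (Integrable.of_bound (μ := P.map Z) hG'm.aestronglyMeasurable ‖u‖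
    (ae_of_all _ hG'b)).exists_boundedContinuous_integral_sub_le (ε := ε / (8 * W)) (by positivity)
  have hφ' : ∫ z, ‖G' z.1 - φ z.1‖ ∂(pairLaw P hZ hY : Measure (E × ℝ)) ≤ ε / (8 * W) := by
    refine le_trans (le_of_eq ?_) hφ
    have hm : Measurable fun z => ‖G' z - φ z‖ := (hG'm.sub φ.continuous.measurable).norm
    simp only [pairLaw, ProbabilityMeasure.coe_mk]
    rw [integral_map (hZ.prodMk hY).aemeasurable (f := fun z : E × ℝ => ‖G' z.1 - φ z.1‖)
      (hm.comp measurable_fst).aestronglyMeasurable,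
      integral_map hZ.aemeasurable hm.aestronglyMeasurable]
  have hφi : ∀ R : ProbabilityMeasure (E × ℝ),
      Integrable (fun z : E × ℝ => φ z.1) (R : Measure (E × ℝ)) := fun R =>
    Integrable.of_bound (φ.continuous.measurable.comp measurable_fst).aestronglyMeasurable ‖φ‖
      (ae_of_all _ fun z => φ.norm_coe_le_norm z.1)
  have hwm : ∀ R : ProbabilityMeasure (E × ℝ),
      AEStronglyMeasurable (fun z : E × ℝ => w z.2) (R : Measure (E × ℝ)) := fun R =>
    (w.continuous.measurable.comp measurable_snd).aestronglyMeasurable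
  have hev := eventually_integral_norm_sub_le hlam u (fun n => (hg n).1) hG'm hgb2
    (ae_of_all _ fun z => hG'b z.1) ec ec' hV hVm heq φ (ε := ε / (8 * W)) (by positivity)
  have hlim := tendsto_integral_of_continuous (𝕜 := ℂ) hlam
    (f := fun z => φ z.1 * w z.2) (by fun_prop) (C := ‖φ‖ * ‖w‖) fun z => by
      rw [norm_mul]
      gcongr
      exacts [φ.norm_coe_le_norm _, w.norm_coe_le_norm _]
  obtain ⟨N1, h1⟩ := eventually_atTop.1 hev
  obtain ⟨N2, h2⟩ := Metric.tendsto_atTop'.1 hlim (ε / 4) (by positivity)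
  refine ⟨max N1 N2, fun n hn => ?_⟩
  have a1 := h1 n ((le_max_left _ _).trans hn.le)
  have a2 := h2 n ((le_max_right _ _).trans_lt hn)
  have a3 := norm_integral_mul_sub_le (pairLaw (P' n) (hZ' n) (hY' n) : Measure (E × ℝ))
    (a := fun z => g n z.1) (b := fun z => φ z.1) (w := fun z => w z.2)
    (Integrable.of_bound ((hg n).1.comp measurable_fst).aestronglyMeasurable ‖u‖ (hgb2 n))
    (hφi _) (hwm _) (fun z => hwW z.2)
  have a4 := norm_integral_mul_sub_le (pairLaw P hZ hY : Measure (E × ℝ))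
    (a := fun z => G' z.1) (b := fun z => φ z.1) (w := fun z => w z.2)
    hG'i (hφi _) (hwm _) (fun z => hwW z.2)
  rw [dist_eq_norm] at a2 ⊢
  have b1 : W * ∫ z, ‖g n z.1 - φ z.1‖ ∂(pairLaw (P' n) (hZ' n) (hY' n) : Measure (E × ℝ))
      ≤ ε / 4 := by
    calc _ ≤ W * (ε / (8 * W) + ε / (8 * W)) := by gcongr; linarith
      _ = ε / 4 := by field_simp; norm_num
  have b2 : W * ∫ z, ‖G' z.1 - φ z.1‖ ∂(pairLaw P hZ hY : Measure (E × ℝ)) ≤ ε / 4 := by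
    calc _ ≤ W * (ε / (8 * W)) := by gcongr
      _ ≤ ε / 4 := by field_simp; norm_num
  rw [norm_sub_rev] at a4
  have t1 := norm_sub_le_norm_sub_add_norm_sub
    (∫ z, g n z.1 * w z.2 ∂(pairLaw (P' n) (hZ' n) (hY' n) : Measure (E × ℝ)))
    (∫ z, φ z.1 * w z.2 ∂(pairLaw (P' n) (hZ' n) (hY' n) : Measure (E × ℝ)))
    (∫ z, G' z.1 * w z.2 ∂(pairLaw P hZ hY : Measure (E × ℝ)))
  have t2 := norm_sub_le_norm_sub_add_norm_sub
    (∫ z, φ z.1 * w z.2 ∂(pairLaw (P' n) (hZ' n) (hY' n) : Measure (E × ℝ)))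
    (∫ z, φ z.1 * w z.2 ∂(pairLaw P hZ hY : Measure (E × ℝ)))
    (∫ z, G' z.1 * w z.2 ∂(pairLaw P hZ hY : Measure (E × ℝ)))
  linarith

omit [MetricSpace E] [ProperSpace E] [BorelSpace E] in
theorem integral_fst_markovProduct {Ω : Type*} [MeasurableSpace Ω] (P : Measure Ω)
    [IsProbabilityMeasure P] {Z : Ω → E} {Y : Ω → ℝ} (hZ : Measurable Z) (hY : Measurable Y)
    (w : ℝ →ᵇ ℝ) : ((∫ p, w p.1 ∂(markovProduct P hZ Y : Measure (ℝ × ℝ)) : ℝ) : ℂ)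
        = ∫ z, (w z.2 : ℂ) ∂(pairLaw P hZ hY : Measure (E × ℝ)) := by
  let wc : ℝ →ᵇ ℂ := BoundedContinuousFunction.ofNormedAddCommGroup (fun y => (w y : ℂ))
    (by fun_prop) ‖w‖ fun y => by rw [Complex.norm_real]; exact w.norm_coe_le_norm y
  have h1 := integral_markovProduct_mul P hZ (Y := Y) wc 1
  have h2 := integral_map_prodMk_mul P hZ hY wc (h := fun _ => 1) measurable_const (C := 1)
    (ae_of_all _ fun _ => by simp)
  have one_bcf : ∀ x : ℝ, (1 : ℝ →ᵇ ℂ) x = 1 := fun _ => rfl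
  simp only [one_bcf, mul_one, one_mul, integral_const, probReal_univ, one_smul] at h1 h2
  rw [← h2] at h1
  rw [← integral_complex_ofReal]
  exact h1

/-- Convergence in distribution and asymptotic equicontinuity of the conditional expectations imply
weak convergence of the Markov products. -/
theorem tendsto_markovProduct {𝒰 : Set (ℝ →ᵇ ℂ)} (h𝒰 : IsConvergenceDetermining 𝒰)
    (hZ : Measurable Z) (hY : Measurable Y)
    (hZ' : ∀ n, Measurable (Z' n)) (hY' : ∀ n, Measurable (Y' n))
    (hlam : TendstoInDistribution (fun n ω => (Z' n ω, Y' n ω)) atTop (fun ω => (Z ω, Y ω)) P' P)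
    {V : Set E} (hV : IsOpen V) (hPV : P {ω | Z ω ∈ V} = 1)
    (h : ∀ u ∈ 𝒰, ∃ g : ℕ → E → ℂ,
      (∀ n, IsCondExpVersion (P' n) (Z' n) (fun ω => u (Y' n ω)) (g n)) ∧
      AsympEquicontinuousOn g V) :
    Tendsto (fun n => markovProduct (P' n) (hZ' n) (Y' n)) atTop (𝓝 (markovProduct P hZ Y)) := by
  have hl : Tendsto (fun n => pairLaw (P' n) (hZ' n) (hY' n)) atTop (𝓝 (pairLaw P hZ hY)) :=
    hlam.tendsto
  refine tendsto_of_tendsto_integral_mul (tendsto_integral_mul h𝒰 (fun w => ?_) fun w u hu => ?_)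
  · have h1 := tendsto_integral_of_continuous (𝕜 := ℂ) hl (f := fun z => (w z.2 : ℂ)) (by fun_prop)
      (C := ‖w‖) fun z => by rw [Complex.norm_real]; exact w.norm_coe_le_norm _
    rw [← integral_fst_markovProduct P hZ hY w] at h1
    simp only [← integral_fst_markovProduct (P' _) (hZ' _) (hY' _) w] at h1
    exact (Complex.continuous_re.tendsto _).comp h1
  · obtain ⟨g, hg, heq⟩ := h u hu
    exact tendsto_integral_markovProduct_mul hZ hY hZ' hY' hl hV hPV u hg heq w

end Convergence

/-! ### Quantile transformation -/

section Quantile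

/-- Right-continuity of the distribution function: the infimum is attained. -/
theorem le_cdf_quantile (μ : Measure ℝ) [IsProbabilityMeasure μ] {t : ℝ} (ht : t ∈ Ioo (0 : ℝ) 1) :
    t ≤ cdf μ (quantile (cdf μ) t) := by
  set S := {x | t ≤ cdf μ x} with hS
  have hne : S.Nonempty := ((tendsto_cdf_atTop μ).eventually_const_le ht.2).exists
  have hright : Tendsto (cdf μ) (𝓝[>] sInf S) (𝓝 (cdf μ (sInf S))) :=
    ((cdf μ).right_continuous (sInf S)).mono_left (nhdsWithin_mono _ Ioi_subset_Ici_self)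
  refine ge_of_tendsto hright (eventually_nhdsWithin_of_forall fun x hx => ?_)
  obtain ⟨y, hy, hyx⟩ := exists_lt_of_csInf_lt hne hx
  exact le_trans hy (monotone_cdf μ hyx.le)

theorem quantile_le_iff (μ : Measure ℝ) [IsProbabilityMeasure μ] {t : ℝ} (ht : t ∈ Ioo (0 : ℝ) 1)
    (x : ℝ) : quantile (cdf μ) t ≤ x ↔ t ≤ cdf μ x := by
  refine ⟨fun h => (le_cdf_quantile μ ht).trans (monotone_cdf μ h), fun h => csInf_le ?_ h⟩
  obtain ⟨y, hy⟩ := ((tendsto_cdf_atBot μ).eventually_lt_const ht.1).exists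
  refine ⟨y, fun x hx => le_of_not_gt fun hxy => ?_⟩
  exact absurd (hx.trans (monotone_cdf μ hxy.le)) (not_le.2 hy)

/-- Monotonicity is available only on `(0, 1)`; elsewhere `sInf` may take its default value. -/
theorem aemeasurable_quantile (μ : Measure ℝ) [IsProbabilityMeasure μ] :
    AEMeasurable (quantile (cdf μ)) (volume.restrict (Ioo (0 : ℝ) 1)) :=
  aemeasurable_restrict_of_monotoneOn measurableSet_Ioo fun _ hs _ ht hst =>
    (quantile_le_iff μ hs _).2 (hst.trans (le_cdf_quantile μ ht))

instance : IsProbabilityMeasure (volume.restrict (Ioo (0 : ℝ) 1)) := ⟨by simp⟩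

/-- The quantile transformation. -/
theorem map_quantile (μ : Measure ℝ) [IsProbabilityMeasure μ] :
    (volume.restrict (Ioo (0 : ℝ) 1)).map (quantile (cdf μ)) = μ := by
  have : IsProbabilityMeasure ((volume.restrict (Ioo (0 : ℝ) 1)).map (quantile (cdf μ))) :=
    Measure.isProbabilityMeasure_map (aemeasurable_quantile μ)
  refine Measure.ext_of_Iic _ _ fun x => ?_
  rw [Measure.map_apply_of_aemeasurable (aemeasurable_quantile μ) measurableSet_Iic,
    Measure.restrict_apply' measurableSet_Ioo]
  have h : quantile (cdf μ) ⁻¹' Iic x ∩ Ioo 0 1 = Iic (cdf μ x) ∩ Ioo 0 1 := by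
    ext t
    simp only [mem_inter_iff, mem_preimage, mem_Iic, and_congr_left_iff]
    exact fun ht => quantile_le_iff μ ht x
  rw [h, ← ofReal_cdf]
  have h0 := cdf_nonneg μ x
  have h1 := cdf_le_one μ x
  refine le_antisymm ?_ ?_
  · refine (measure_mono (t := Ioc 0 (cdf μ x)) fun t ht => ⟨ht.2.1, ht.1⟩).trans ?_
    simp
  · refine le_trans ?_ (measure_mono (s := Ioo 0 (cdf μ x)) fun t ht =>
      ⟨ht.2.le, ht.1, ht.2.trans_le h1⟩)
    simp

end Quantile

/-! ### Probabilities of `A ≤ B` and their limits -/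

section Concordance

variable (μ ρ : Measure ℝ) [IsProbabilityMeasure μ] [IsProbabilityMeasure ρ]

/-- The probability that `A ≤ B` for independent `A` and `B` with laws `μ` and `ρ`. -/
def probLe (μ ρ : Measure ℝ) : ℝ := (μ.prod ρ).real {p | p.1 ≤ p.2}

theorem isClosed_setOf_fst_le_snd : IsClosed {p : ℝ × ℝ | p.1 ≤ p.2} :=
  isClosed_le continuous_fst continuous_snd

theorem measurable_measureReal_Ici (ρ : Measure ℝ) [IsProbabilityMeasure ρ] :
    Measurable fun y => ρ.real (Ici y) :=
  (show Antitone fun y => ρ.real (Ici y) from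
    fun _ _ h => measureReal_mono (Ici_subset_Ici.2 h)).measurable

theorem integrable_measureReal_Ici : Integrable (fun y => ρ.real (Ici y)) μ :=
  Integrable.of_bound (measurable_measureReal_Ici ρ).aestronglyMeasurable 1
    (ae_of_all _ fun _ => by
      rw [Real.norm_of_nonneg measureReal_nonneg]; exact measureReal_le_one)

omit [IsProbabilityMeasure μ] in
theorem integral_measureReal_Ici : ∫ y, ρ.real (Ici y) ∂μ = probLe μ ρ := by
  rw [probLe, measureReal_def, Measure.prod_apply isClosed_setOf_fst_le_snd.measurableSet,
    ← integral_toReal]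
  · rfl
  · exact (measurable_measure_prodMk_left isClosed_setOf_fst_le_snd.measurableSet).aemeasurable
  · exact ae_of_all _ fun _ => measure_lt_top _ _

/-- Conditioning on the larger variable gives `𝔼[F(B)]`, and `B` is realised as `F⁻¹` of a uniform
variable. -/
theorem probLe_self : probLe μ μ
    = ∫ t, cdf μ (quantile (cdf μ) t) ∂(volume.restrict (Ioo (0 : ℝ) 1)) := by
  have h1 : probLe μ μ = ∫ x, cdf μ x ∂μ := by
    rw [probLe, measureReal_def, Measure.prod_apply_symm isClosed_setOf_fst_le_snd.measurableSet,
      ← integral_toReal]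
    · simp only [cdf_eq_real]
      rfl
    · exact (measurable_measure_prodMk_right isClosed_setOf_fst_le_snd.measurableSet).aemeasurable
    · exact ae_of_all _ fun _ => measure_lt_top _ _
  have h2 := integral_map (aemeasurable_quantile μ) (f := cdf μ)
    (monotone_cdf μ).measurable.aestronglyMeasurable
  rw [map_quantile] at h2
  exact h1.trans h2

theorem tendsto_probLe_self {μ : Measure ℝ} [IsProbabilityMeasure μ] {μ' : ℕ → Measure ℝ}
    [∀ n, IsProbabilityMeasure (μ' n)]
    (h : ∀ᵐ t ∂volume.restrict (Ioo (0 : ℝ) 1),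
      Tendsto (fun n => cdf (μ' n) (quantile (cdf (μ' n)) t)) atTop
        (𝓝 (cdf μ (quantile (cdf μ) t)))) :
    Tendsto (fun n => probLe (μ' n) (μ' n)) atTop (𝓝 (probLe μ μ)) := by
  simp only [probLe_self]
  refine tendsto_integral_of_dominated_convergence (fun _ => 1) (fun n => ?_)
    (integrable_const _) (fun n => ae_of_all _ fun t => ?_) h
  · exact ((monotone_cdf (μ' n)).measurable.comp_aemeasurable
      (aemeasurable_quantile (μ' n))).aestronglyMeasurable
  · rw [Real.norm_of_nonneg (cdf_nonneg _ _)]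
    exact cdf_le_one _ _

/-- The law of the minimum of the coordinates. -/
def minLaw (Q : Measure (ℝ × ℝ)) : Measure ℝ := Q.map fun p => min p.1 p.2

/-- The law of the maximum of the coordinates. -/
def maxLaw (Q : Measure (ℝ × ℝ)) : Measure ℝ := Q.map fun p => max p.1 p.2

instance (Q : Measure (ℝ × ℝ)) [IsProbabilityMeasure Q] : IsProbabilityMeasure (minLaw Q) :=
  Measure.isProbabilityMeasure_map (by fun_prop)

instance (Q : Measure (ℝ × ℝ)) [IsProbabilityMeasure Q] : IsProbabilityMeasure (maxLaw Q) :=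
  Measure.isProbabilityMeasure_map (by fun_prop)

theorem minLaw_real_Ici (Q : Measure (ℝ × ℝ)) (y : ℝ) :
    (minLaw Q).real (Ici y) = Q.real (Ici y ×ˢ Ici y) := by
  rw [minLaw, map_measureReal_apply (by fun_prop) measurableSet_Ici]
  congr 1
  ext p
  simp [Prod.le_def]

theorem maxLaw_real_Ici (Q : Measure (ℝ × ℝ)) (y : ℝ) :
    (maxLaw Q).real (Ici y) = Q.real (Prod.fst ⁻¹' Ici y ∪ Prod.snd ⁻¹' Ici y) := by
  rw [maxLaw, map_measureReal_apply (by fun_prop) measurableSet_Ici]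
  congr 1
  ext p
  simp

variable {μ} in
-- Inclusion–exclusion for the events that the coordinates are at least `y`, integrated over `y`.
theorem probLe_minLaw_add_probLe_maxLaw {Q : Measure (ℝ × ℝ)} [IsProbabilityMeasure Q]
    (h1 : Q.map Prod.fst = μ) (h2 : Q.map Prod.snd = μ) :
    probLe μ (minLaw Q) + probLe μ (maxLaw Q) = 2 * probLe μ μ := by
  simp only [← integral_measureReal_Ici]
  rw [← integral_add (integrable_measureReal_Ici _ _) (integrable_measureReal_Ici _ _),
    ← integral_const_mul]
  refine integral_congr_ae (ae_of_all _ fun y => ?_)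
  have e1 : Q.real (Prod.fst ⁻¹' Ici y) = μ.real (Ici y) := by
    rw [← h1, map_measureReal_apply measurable_fst measurableSet_Ici]
  have e2 : Q.real (Prod.snd ⁻¹' Ici y) = μ.real (Ici y) := by
    rw [← h2, map_measureReal_apply measurable_snd measurableSet_Ici]
  have e3 := measureReal_union_add_inter (μ := Q) (s := Prod.fst ⁻¹' Ici y)
    (t := Prod.snd ⁻¹' Ici y) (measurable_snd measurableSet_Ici)
  simp only [minLaw_real_Ici, maxLaw_real_Ici, Set.prod_eq]
  linarith

theorem eventually_measureReal_lt_of_isClosed {S : Type*} [TopologicalSpace S] [MeasurableSpace S]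
    [OpensMeasurableSpace S] [HasOuterApproxClosed S] {ρ : ℕ → ProbabilityMeasure S}
    {ρ' : ProbabilityMeasure S} (h : Tendsto ρ atTop (𝓝 ρ')) {F : Set S} (hF : IsClosed F)
    {ε : ℝ} (hε : 0 < ε) :
    ∀ᶠ n in atTop, (ρ n : Measure S).real F < (ρ' : Measure S).real F + ε := by
  have h1 := ProbabilityMeasure.limsup_measure_closed_le_of_tendsto h hF
  have h2 : (ρ' : Measure S) F < ENNReal.ofReal ((ρ' : Measure S).real F + ε) := by
    rw [ENNReal.lt_ofReal_iff_toReal_lt (measure_ne_top _ _)]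
    exact lt_add_of_pos_right _ hε
  filter_upwards [eventually_lt_of_limsup_lt (h1.trans_lt h2)] with n hn
  rwa [ENNReal.lt_ofReal_iff_toReal_lt (measure_ne_top _ _)] at hn

/-- Portmanteau for the closed set `{a ≤ b}` under the product laws. Only the upper bound is
available, since the diagonal may carry mass. -/
theorem eventually_probLe_map_lt {μ : ℕ → ProbabilityMeasure ℝ} {μ' : ProbabilityMeasure ℝ}
    (hμ : Tendsto μ atTop (𝓝 μ')) {Q : ℕ → ProbabilityMeasure (ℝ × ℝ)}
    {Q' : ProbabilityMeasure (ℝ × ℝ)} (hQ : Tendsto Q atTop (𝓝 Q')) {f : ℝ × ℝ → ℝ}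
    (hf : Continuous f) {ε : ℝ} (hε : 0 < ε) :
    ∀ᶠ n in atTop, probLe (μ n) ((Q n : Measure (ℝ × ℝ)).map f)
      < probLe μ' ((Q' : Measure (ℝ × ℝ)).map f) + ε := by
  have h1 := ProbabilityMeasure.tendsto_map_of_tendsto_of_continuous _ _ hQ hf
  have h2 := (ProbabilityMeasure.continuous_prod.tendsto (μ', Q'.map hf.measurable.aemeasurable)).comp
    (hμ.prodMk_nhds h1)
  exact eventually_measureReal_lt_of_isClosed h2 isClosed_setOf_fst_le_snd hε

/-- Weak convergence of couplings and convergence of `P(Y ≤ Y')`, for independent copies, imply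
convergence of the probability that a copy is at most the minimum of the coupled pair. -/
theorem tendsto_probLe_minLaw {μ : ℕ → ProbabilityMeasure ℝ} {μ' : ProbabilityMeasure ℝ}
    (hμ : Tendsto μ atTop (𝓝 μ')) {Q : ℕ → ProbabilityMeasure (ℝ × ℝ)}
    {Q' : ProbabilityMeasure (ℝ × ℝ)} (hQ : Tendsto Q atTop (𝓝 Q'))
    (h1 : ∀ n, (Q n : Measure (ℝ × ℝ)).map Prod.fst = μ n)
    (h2 : ∀ n, (Q n : Measure (ℝ × ℝ)).map Prod.snd = μ n)
    (h1' : (Q' : Measure (ℝ × ℝ)).map Prod.fst = μ')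
    (h2' : (Q' : Measure (ℝ × ℝ)).map Prod.snd = μ')
    (hc : Tendsto (fun n => probLe (μ n) (μ n)) atTop (𝓝 (probLe μ' μ'))) :
    Tendsto (fun n => probLe (μ n) (minLaw (Q n))) atTop (𝓝 (probLe μ' (minLaw Q'))) := by
  rw [Metric.tendsto_nhds]
  intro ε hε
  have a1 := eventually_probLe_map_lt hμ hQ (f := fun p => min p.1 p.2) (by fun_prop)
    (half_pos hε)
  have a2 := eventually_probLe_map_lt hμ hQ (f := fun p => max p.1 p.2) (by fun_prop)
    (half_pos hε)
  -- For the lower bound, `min` is twice `P(A ≤ B)` minus `max`: the losses are `2 * (ε / 4)` and `ε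
  -- / 2`.
  have a3 := hc.eventually_const_lt (show probLe μ' μ' - ε / 4 < probLe μ' μ' by linarith)
  filter_upwards [a1, a2, a3] with n b1 b2 b3
  have s1 := probLe_minLaw_add_probLe_maxLaw (h1 n) (h2 n)
  have s2 := probLe_minLaw_add_probLe_maxLaw h1' h2'
  simp only [minLaw, maxLaw] at s1 s2 ⊢
  rw [Real.dist_eq, abs_lt]
  constructor <;> linarith

theorem integral_sq_measureReal_Ici :
    ∫ y, μ.real (Ici y) ^ 2 ∂μ = probLe μ (minLaw (μ.prod μ)) := by
  rw [← integral_measureReal_Ici]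
  refine integral_congr_ae (ae_of_all _ fun y => ?_)
  simp only [minLaw_real_Ici, measureReal_prod_prod, sq]

/-- The set is locally null: a point of it either has a smaller point `z` of the set below it, with
`Ici z` a null neighbourhood, or is the least point `y`, and then the whole set lies in the null set
`Ici y`. -/
theorem measure_setOf_measureReal_Ici_eq_zero : μ {y | μ.real (Ici y) = 0} = 0 := by
  refine measure_null_of_locally_null _ fun y hy => ?_
  have h0 : ∀ z ∈ {y | μ.real (Ici y) = 0}, μ (Ici z) = 0 := fun z hz => by
    simpa [measureReal_def, ENNReal.toReal_eq_zero_iff] using hz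
  by_cases h : ∃ z ∈ {y | μ.real (Ici y) = 0}, z < y
  · obtain ⟨z, hz, hzy⟩ := h
    exact ⟨Ici z, mem_nhdsWithin_of_mem_nhds (Ici_mem_nhds hzy), h0 z hz⟩
  · push Not at h
    exact ⟨Ici y, mem_of_superset self_mem_nhdsWithin h, h0 y hy⟩

/-- Positivity of the denominator of `ξ`. As `s² ≤ s` on `[0, 1]` with equality only at the
endpoints, equal integrals would force `μ.real (Ici y)` to be `0` or `1` almost surely. -/
theorem probLe_minLaw_prod_lt (hnd : ∀ c : ℝ, ¬ ∀ᵐ y ∂μ, y = c) :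
    probLe μ (minLaw (μ.prod μ)) < probLe μ μ := by
  have hi2 : Integrable (fun y => μ.real (Ici y) ^ 2) μ :=
    Integrable.of_bound ((measurable_measureReal_Ici μ).pow_const 2).aestronglyMeasurable 1
      (ae_of_all _ fun y => by
        rw [Real.norm_of_nonneg (sq_nonneg _)]
        exact pow_le_one₀ measureReal_nonneg measureReal_le_one)
  have hle : (fun y => μ.real (Ici y) ^ 2) ≤ fun y => μ.real (Ici y) := fun y =>
    pow_le_of_le_one measureReal_nonneg measureReal_le_one two_ne_zero
  rw [← integral_sq_measureReal_Ici, ← integral_measureReal_Ici]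
  refine lt_of_le_of_ne (integral_mono hi2 (integrable_measureReal_Ici μ μ) hle) fun heq => ?_
  have h1 := (integral_eq_iff_of_ae_le hi2 (integrable_measureReal_Ici μ μ) (ae_of_all _ hle)).1 heq
  have h2 : ∀ᵐ y ∂μ, ∀ᵐ x ∂μ, y ≤ x := by
    have h0 : ∀ᵐ y ∂μ, μ.real (Ici y) ≠ 0 := measure_eq_zero_iff_ae_notMem.1
      (measure_setOf_measureReal_Ici_eq_zero μ)
    filter_upwards [h1, h0] with y hy hy0
    have h3 : μ.real (Ici y) = 1 := by
      have : μ.real (Ici y) * (μ.real (Ici y) - 1) = 0 := by linear_combination hy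
      rcases mul_eq_zero.1 this with h | h
      · exact absurd h hy0
      · linarith
    have h4 : μ (Ici y) = 1 := by
      rw [measureReal_def] at h3
      rw [← ENNReal.ofReal_toReal (measure_ne_top μ (Ici y)), h3, ENNReal.ofReal_one]
    exact (prob_compl_eq_zero_iff measurableSet_Ici).2 h4
  -- By Fubini the roles of the two independent copies can be swapped, so both inequalities hold and
  -- the law is a point mass.
  have h3 : ∀ᵐ x ∂μ, ∀ᵐ y ∂μ, y ≤ x := by
    refine (Measure.ae_ae_comm (μ := μ) (ν := μ) (p := fun y x => y ≤ x) ?_).1 h2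
    exact isClosed_setOf_fst_le_snd.measurableSet
  obtain ⟨c, hc1, hc2⟩ := (h2.and h3).exists
  refine hnd c ?_
  filter_upwards [hc1, hc2] with y h4 h5
  exact le_antisymm h5 h4

theorem probLe_minLaw_le {Q : Measure (ℝ × ℝ)} [IsProbabilityMeasure Q]
    (h1 : Q.map Prod.fst = μ) : probLe μ (minLaw Q) ≤ probLe μ μ := by
  simp only [← integral_measureReal_Ici]
  refine integral_mono (integrable_measureReal_Ici _ _) (integrable_measureReal_Ici _ _) fun y => ?_
  simp only
  rw [minLaw_real_Ici, ← h1, map_measureReal_apply measurable_fst measurableSet_Ici]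
  exact measureReal_mono fun p hp => hp.1

end Concordance

/-! ### Rank correlation through the Markov product -/

section Xi

variable {Ω E : Type*} [MeasurableSpace Ω] [mE : MeasurableSpace E] (P : Measure Ω)
  [IsProbabilityMeasure P] {Z : Ω → E} (hZ : Measurable Z) {Y : Ω → ℝ} (hY : Measurable Y)

theorem markovProduct_apply_prod (Y : Ω → ℝ) {A B : Set ℝ} (hA : MeasurableSet A)
    (hB : MeasurableSet B) : (markovProduct P hZ Y : Measure (ℝ × ℝ)) (A ×ˢ B)
      = ∫⁻ z, condDistrib Y Z P z A * condDistrib Y Z P z B ∂(P.map Z) := by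
  rw [coe_markovProduct, Measure.bind_apply (hA.prod hB) (Kernel.aemeasurable _)]
  refine lintegral_congr fun z => ?_
  rw [Kernel.prod_apply, Measure.prod_prod]

include hZ hY in
theorem lintegral_condDistrib_apply {A : Set ℝ} (hA : MeasurableSet A) :
    ∫⁻ z, condDistrib Y Z P z A ∂(P.map Z) = P.map Y A := by
  rw [← condDistrib_comp_map hZ.aemeasurable hY.aemeasurable (μ := P),
    Measure.bind_apply hA (Kernel.aemeasurable _)]

include hY in
theorem map_fst_markovProduct :
    (markovProduct P hZ Y : Measure (ℝ × ℝ)).map Prod.fst = P.map Y := by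
  ext A hA
  rw [Measure.map_apply measurable_fst hA, ← prod_univ, markovProduct_apply_prod P hZ Y hA
    MeasurableSet.univ]
  simp only [measure_univ, mul_one]
  exact lintegral_condDistrib_apply P hZ hY hA

include hY in
theorem map_snd_markovProduct :
    (markovProduct P hZ Y : Measure (ℝ × ℝ)).map Prod.snd = P.map Y := by
  ext A hA
  rw [Measure.map_apply measurable_snd hA, ← univ_prod, markovProduct_apply_prod P hZ Y
    MeasurableSet.univ hA]
  simp only [measure_univ, one_mul]
  exact lintegral_condDistrib_apply P hZ hY hA

include hY in
-- The second moment of `P(Y ≥ y | Z)` is the probability that both coordinates of the Markov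
-- product are at least `y`.
theorem variance_condExp_Ici (y : ℝ) :
    Var[P⟦{ω | y ≤ Y ω} | mE.comap Z⟧; P]
      = (minLaw (markovProduct P hZ Y)).real (Ici y) - (P.map Y).real (Ici y) ^ 2 := by
  have h1 := condDistrib_ae_eq_condExp (μ := P) hZ hY (measurableSet_Ici (a := y))
  have hm : Measurable fun z => (condDistrib Y Z P z).real (Ici y) :=
    (Kernel.measurable_coe _ measurableSet_Ici).ennreal_toReal
  change Var[P⟦Y ⁻¹' Ici y | mE.comap Z⟧; P] = _
  rw [← variance_congr h1, variance_eq_sub]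
  · have e1 : ∫ ω, (condDistrib Y Z P (Z ω)).real (Ici y) ∂P = (P.map Y).real (Ici y) := by
      rw [integral_congr_ae h1, integral_condExp hZ.comap_le, map_measureReal_apply hY measurableSet_Ici]
      exact integral_indicator_one (hY measurableSet_Ici)
    have e2 : ∫ ω, ((fun ω => (condDistrib Y Z P (Z ω)).real (Ici y)) ^ 2) ω ∂P
        = (minLaw (markovProduct P hZ Y)).real (Ici y) := by
      rw [minLaw_real_Ici, measureReal_def, markovProduct_apply_prod P hZ Y measurableSet_Ici
        measurableSet_Ici, ← integral_toReal]
      · rw [integral_map hZ.aemeasurable]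
        · refine integral_congr_ae (ae_of_all _ fun ω => ?_)
          simp [measureReal_def, sq, ENNReal.toReal_mul]
        · exact (((Kernel.measurable_coe _ measurableSet_Ici).mul
            (Kernel.measurable_coe _ measurableSet_Ici)).ennreal_toReal).aestronglyMeasurable
      · exact ((Kernel.measurable_coe _ measurableSet_Ici).mul
            (Kernel.measurable_coe _ measurableSet_Ici)).aemeasurable
      · exact ae_of_all _ fun z => ENNReal.mul_lt_top (measure_lt_top _ _) (measure_lt_top _ _)
    rw [e1, e2]
  · exact MemLp.of_bound (hm.comp hZ).aestronglyMeasurable 1 (ae_of_all _ fun ω => by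
      change ‖(condDistrib Y Z P (Z ω)).real (Ici y)‖ ≤ 1
      rw [Real.norm_of_nonneg measureReal_nonneg]; exact measureReal_le_one)

include hY in
theorem variance_indicator_Ici (y : ℝ) :
    Var[{ω | y ≤ Y ω}.indicator (fun _ => (1 : ℝ)); P]
      = (P.map Y).real (Ici y) - (P.map Y).real (Ici y) ^ 2 := by
  have hs : MeasurableSet {ω | y ≤ Y ω} := hY measurableSet_Ici
  have e1 : ∫ ω, {ω | y ≤ Y ω}.indicator (fun _ => (1 : ℝ)) ω ∂P = (P.map Y).real (Ici y) := by
    rw [map_measureReal_apply hY measurableSet_Ici]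
    exact integral_indicator_one hs
  rw [variance_eq_sub (MemLp.of_bound (measurable_const.indicator hs).aestronglyMeasurable 1
    (ae_of_all _ fun ω => by
      by_cases h : ω ∈ {ω | y ≤ Y ω} <;> simp [indicator, h]))]
  rw [e1]
  congr 1
  rw [← e1]
  refine integral_congr_ae (ae_of_all _ fun ω => ?_)
  by_cases h : ω ∈ {ω | y ≤ Y ω} <;> simp [indicator, h]

include hY in
/-- `ξ` in terms of the Markov product. -/
theorem xi_eq : xi P Y Z
    = (probLe (P.map Y) (minLaw (markovProduct P hZ Y))
        - probLe (P.map Y) (minLaw ((P.map Y).prod (P.map Y)))) /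
      (probLe (P.map Y) (P.map Y) - probLe (P.map Y) (minLaw ((P.map Y).prod (P.map Y)))) := by
  have : IsProbabilityMeasure (P.map Y) := Measure.isProbabilityMeasure_map hY.aemeasurable
  have hi2 : Integrable (fun y => (P.map Y).real (Ici y) ^ 2) (P.map Y) :=
    Integrable.of_bound ((measurable_measureReal_Ici _).pow_const 2).aestronglyMeasurable 1
      (ae_of_all _ fun y => by
        rw [Real.norm_of_nonneg (sq_nonneg _)]
        exact pow_le_one₀ measureReal_nonneg measureReal_le_one)
  simp only [xi, variance_condExp_Ici P hZ hY, variance_indicator_Ici P hY]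
  rw [integral_sub (integrable_measureReal_Ici _ _) hi2,
    integral_sub (integrable_measureReal_Ici _ _) hi2, integral_sq_measureReal_Ici,
    integral_measureReal_Ici, integral_measureReal_Ici]

omit [IsProbabilityMeasure P] in
include hY in
theorem not_ae_map_eq_const (hnd : ∀ c : ℝ, ¬ ∀ᵐ ω ∂P, Y ω = c) (c : ℝ) :
    ¬ ∀ᵐ y ∂(P.map Y), y = c := fun h => hnd c (ae_of_ae_map hY.aemeasurable h)

include hZ hY in
-- The minimum of the Markov pair is at most its first coordinate, which has the law of `Y`.
theorem xi_le_one (hnd : ∀ c : ℝ, ¬ ∀ᵐ ω ∂P, Y ω = c) : xi P Y Z ≤ 1 := by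
  have : IsProbabilityMeasure (P.map Y) := Measure.isProbabilityMeasure_map hY.aemeasurable
  have h1 := probLe_minLaw_prod_lt (P.map Y) (not_ae_map_eq_const P hY hnd)
  have h2 := probLe_minLaw_le (P.map Y) (map_fst_markovProduct P hZ hY)
  rw [xi_eq P hZ hY, div_le_one (by linarith)]
  linarith

variable {P} {Ω' : ℕ → Type*} [∀ n, MeasurableSpace (Ω' n)] {P' : ∀ n, Measure (Ω' n)}
  [∀ n, IsProbabilityMeasure (P' n)] {Z' : ∀ n, Ω' n → E} {Y' : ∀ n, Ω' n → ℝ}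

include hY in
theorem tendsto_xi (hZ' : ∀ n, Measurable (Z' n)) (hY' : ∀ n, Measurable (Y' n))
    (hnd : ∀ c : ℝ, ¬ ∀ᵐ ω ∂P, Y ω = c)
    (hQ : Tendsto (fun n => markovProduct (P' n) (hZ' n) (Y' n)) atTop
      (𝓝 (markovProduct P hZ Y)))
    (hF : ∀ᵐ t ∂volume.restrict (Ioo (0 : ℝ) 1),
      Tendsto (fun n => cdf ((P' n).map (Y' n)) (quantile (cdf ((P' n).map (Y' n))) t)) atTop
        (𝓝 (cdf (P.map Y) (quantile (cdf (P.map Y)) t)))) :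
    Tendsto (fun n => xi (P' n) (Y' n) (Z' n)) atTop (𝓝 (xi P Y Z)) := by
  have i1 : IsProbabilityMeasure (P.map Y) := Measure.isProbabilityMeasure_map hY.aemeasurable
  have i2 : ∀ n, IsProbabilityMeasure ((P' n).map (Y' n)) := fun n =>
    Measure.isProbabilityMeasure_map (hY' n).aemeasurable
  let μ : ℕ → ProbabilityMeasure ℝ := fun n => ⟨(P' n).map (Y' n), i2 n⟩
  let μ' : ProbabilityMeasure ℝ := ⟨P.map Y, i1⟩
  have hμ : Tendsto μ atTop (𝓝 μ') := by
    have h1 := ProbabilityMeasure.tendsto_map_of_tendsto_of_continuous _ _ hQ continuous_fst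
    have e1 : ∀ n, (markovProduct (P' n) (hZ' n) (Y' n)).map continuous_fst.measurable.aemeasurable
        = μ n := fun n => Subtype.ext (map_fst_markovProduct (P' n) (hZ' n) (hY' n))
    have e2 : (markovProduct P hZ Y).map continuous_fst.measurable.aemeasurable
        = μ' := Subtype.ext (map_fst_markovProduct P hZ hY)
    simpa only [e1, e2] using h1
  have hc : Tendsto (fun n => probLe (μ n) (μ n)) atTop (𝓝 (probLe μ' μ')) :=
    tendsto_probLe_self hF
  have hA := tendsto_probLe_minLaw hμ hQ (fun n => map_fst_markovProduct (P' n) (hZ' n) (hY' n))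
    (fun n => map_snd_markovProduct (P' n) (hZ' n) (hY' n)) (map_fst_markovProduct P hZ hY)
    (map_snd_markovProduct P hZ hY) hc
  -- The same convergence result for the independent coupling handles the subtracted term.
  have hB := tendsto_probLe_minLaw hμ (Q := fun n => (μ n).prod (μ n)) (Q' := μ'.prod μ')
    ((ProbabilityMeasure.continuous_prod.tendsto (μ', μ')).comp (hμ.prodMk_nhds hμ))
    (fun n => by simp) (fun n => by simp) (by simp) (by simp) hc
  have hpos := probLe_minLaw_prod_lt (P.map Y) (not_ae_map_eq_const P hY hnd)
  rw [xi_eq P hZ hY]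
  simp only [fun n => xi_eq (P' n) (hZ' n) (hY' n)]
  -- Only the limiting denominator must be nonzero; degenerate early terms, where division by zero
  -- returns `0`, do no harm.
  exact (hA.sub hB).div (hc.sub hB)
    (sub_pos.2 hpos).ne'

end Xi

end MultiOutput

end

/-! ### Assembly over the components -/

theorem mainTheorem6 {p q : ℕ}
    {Ω : Type*} [MeasurableSpace Ω] (P : Measure Ω) [IsProbabilityMeasure P]
    {Ω' : ℕ → Type*} [∀ n, MeasurableSpace (Ω' n)] (P' : ∀ n, Measure (Ω' n))
    [∀ n, IsProbabilityMeasure (P' n)]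
    (X : Ω → Fin p → ℝ) (Y : Ω → Fin q → ℝ) (hX : Measurable X) (hY : Measurable Y)
    (X' : ∀ n, Ω' n → Fin p → ℝ) (Y' : ∀ n, Ω' n → Fin q → ℝ)
    (hX' : ∀ n, Measurable (X' n)) (hY' : ∀ n, Measurable (Y' n)) :
    -- (a)
    (∀ (𝒰 : Set (ℝ →ᵇ ℂ)), MultiOutput.IsConvergenceDetermining 𝒰 →
      ∀ (V : ∀ i : Fin q, Set ((Fin p → ℝ) × (Fin i.val → ℝ)))
        (U : ∀ i : Fin q, Set (Fin i.val → ℝ)),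
        (∀ i, IsOpen (V i) ∧ P {ω | MultiOutput.inputPrev X Y i ω ∈ V i} = 1) →
        (∀ i, 0 < i.val → IsOpen (U i) ∧ P {ω | MultiOutput.prev Y i ω ∈ U i} = 1) →
        TendstoInDistribution (fun n ω => (X' n ω, Y' n ω)) atTop (fun ω => (X ω, Y ω)) P' P →
        (∀ i, ∀ u ∈ 𝒰, ∃ g : ℕ → (Fin p → ℝ) × (Fin i.val → ℝ) → ℂ,
          (∀ n, MultiOutput.IsCondExpVersion (P' n) (MultiOutput.inputPrev (X' n) (Y' n) i)
            (fun ω => u (Y' n ω i)) (g n)) ∧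
          MultiOutput.AsympEquicontinuousOn g (V i)) →
        (∀ i, 0 < i.val → ∀ u ∈ 𝒰, ∃ g : ℕ → (Fin i.val → ℝ) → ℂ,
          (∀ n, MultiOutput.IsCondExpVersion (P' n) (MultiOutput.prev (Y' n) i)
            (fun ω => u (Y' n ω i)) (g n)) ∧
          MultiOutput.AsympEquicontinuousOn g (U i)) →
        (∀ i, Tendsto (fun n => MultiOutput.markovProduct (P' n)
            (MultiOutput.measurable_inputPrev (hX' n) (hY' n) i) (fun ω => Y' n ω i)) atTop
          (𝓝 (MultiOutput.markovProduct P
            (MultiOutput.measurable_inputPrev hX hY i) (fun ω => Y ω i)))) ∧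
        (∀ i, 0 < i.val → Tendsto (fun n => MultiOutput.markovProduct (P' n)
            (MultiOutput.measurable_prev (hY' n) i) (fun ω => Y' n ω i)) atTop
          (𝓝 (MultiOutput.markovProduct P
            (MultiOutput.measurable_prev hY i) (fun ω => Y ω i))))) ∧
    -- (b)
    ((∀ (i : Fin q) (c : ℝ), ¬ ∀ᵐ ω ∂P, Y ω i = c) →
      (∀ i, Tendsto (fun n => MultiOutput.markovProduct (P' n)
          (MultiOutput.measurable_inputPrev (hX' n) (hY' n) i) (fun ω => Y' n ω i)) atTop
        (𝓝 (MultiOutput.markovProduct P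
          (MultiOutput.measurable_inputPrev hX hY i) (fun ω => Y ω i)))) →
      (∀ i, 0 < i.val → Tendsto (fun n => MultiOutput.markovProduct (P' n)
          (MultiOutput.measurable_prev (hY' n) i) (fun ω => Y' n ω i)) atTop
        (𝓝 (MultiOutput.markovProduct P
          (MultiOutput.measurable_prev hY i) (fun ω => Y ω i)))) →
      (∀ i : Fin q, ∀ᵐ t ∂volume.restrict (Ioo (0 : ℝ) 1),
        Tendsto (fun n => cdf ((P' n).map (fun ω => Y' n ω i))
            (MultiOutput.quantile (cdf ((P' n).map (fun ω => Y' n ω i))) t)) atTop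
          (𝓝 (cdf (P.map (fun ω => Y ω i))
            (MultiOutput.quantile (cdf (P.map (fun ω => Y ω i))) t)))) →
      Tendsto (fun n => MultiOutput.T (P' n) (Y' n) (X' n)) atTop
        (𝓝 (MultiOutput.T P Y X))) := by
  refine ⟨?_, ?_⟩
  · intro 𝒰 h𝒰 V U hV hU hconv hgV hgU
    refine ⟨fun i => ?_, fun i hi => ?_⟩
    · refine MultiOutput.tendsto_markovProduct h𝒰 _ ((measurable_pi_apply i).comp hY) _
        (fun n => (measurable_pi_apply i).comp (hY' n)) ?_ (hV i).1 (hV i).2 (hgV i)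
      -- Continuous mapping theorem for the coordinate selection.
      exact hconv.continuous_comp (g := fun z : (Fin p → ℝ) × (Fin q → ℝ) =>
        ((z.1, fun j : Fin i.val => z.2 (Fin.castLE i.isLt.le j)), z.2 i)) (by fun_prop)
    · refine MultiOutput.tendsto_markovProduct h𝒰 _ ((measurable_pi_apply i).comp hY) _
        (fun n => (measurable_pi_apply i).comp (hY' n)) ?_ (hU i hi).1 (hU i hi).2 (hgU i hi)
      exact hconv.continuous_comp (g := fun z : (Fin p → ℝ) × (Fin q → ℝ) =>
        ((fun j : Fin i.val => z.2 (Fin.castLE i.isLt.le j)), z.2 i)) (by fun_prop)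
  · intro hnd hQ hQ' hF
    have hYi : ∀ i, Measurable fun ω => Y ω i := fun i => (measurable_pi_apply i).comp hY
    have hYi' : ∀ i n, Measurable fun ω => Y' n ω i := fun i n =>
      (measurable_pi_apply i).comp (hY' n)
    -- Without components, `T` is constantly `1` because `0 / 0 = 0`.
    rcases Nat.eq_zero_or_pos q with rfl | hq
    · simp [MultiOutput.T]
    refine tendsto_const_nhds.sub (Tendsto.div (tendsto_const_nhds.sub
      (tendsto_finsetSum _ fun i _ => ?_)) (tendsto_const_nhds.sub
      (tendsto_finsetSum _ fun i _ => ?_)) (sub_pos.2 ?_).ne')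
    · exact MultiOutput.tendsto_xi _ (hYi i) _ (hYi' i) (hnd i) (hQ i) (hF i)
    · split_ifs with hi
      · exact tendsto_const_nhds
      · exact MultiOutput.tendsto_xi _ (hYi i) _ (hYi' i) (hnd i) (hQ' i (Nat.pos_of_ne_zero hi))
          (hF i)
    -- The denominator of `T` is positive: every summand is at most `1` and the first is `0` by
    -- convention.
    · calc _ < ∑ _i : Fin q, (1 : ℝ) := by
            refine Finset.sum_lt_sum (fun i _ => ?_) ⟨⟨0, hq⟩, Finset.mem_univ _, by simp⟩
            split_ifs
            · exact zero_le_one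
            · exact MultiOutput.xi_le_one P (MultiOutput.measurable_prev hY i) (hYi i) (hnd i)
        _ = q := by simp
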